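/- Let $K$ be a number field and let $\Omega^0$ be a finite set of finite places of $K$ not dividing $2$. For a place $\pi$ of $K$ write $K_\pi^{*2}$ for the set of nonzero squares of the completion $K_\pi$; for an element $p\in\mathcal{O}_K$ generating a prime ideal write $K_p$ for the completion at that prime. Let $a,b,c,d\in\mathcal{O}_K$ satisfy: (i) $a,b,c,d$ generate distinct nonzero prime ideals of $\mathcal{O}_K$, none of which corresponds to a place in $\Omega^0$ or a place dividing $2$; (ii) $a,b\in K_\pi^{*2}$ for every $\pi\in\Omega^0$, every archimedean $\pi$ and every $\pi\mid 2$; (iii) $2,-1\in K_a^{*2}$ and $2,-1\in K_b^{*2}$; (iv) $a\equiv 1 \bmod b$ and $bc^2d\equiv 1\bmod a$; (v) $c\notin K_a^{*2}$, $c\notin K_b^{*2}$, $d\notin K_b^{*2}$, $d\in K_c^{*2}$; (vi) $a\in K_b^{*2}$, $a\notin K_c^{*2}$, $b\in K_a^{*2}$, $b\notin K_c^{*2}$, $d\in K_a^{*2}$; (vii) $a\nmid bcd+2$. Let $h,g\ge 0$ be integers. Define $\mathbf{S}'\subset\mathbb{P}^4\times\mathbb{A}^1$ over $K$, with homogeneous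 coordinates $(x':y':z':u':v')$ and affine coordinate $\theta'$, by $$x'^2-az'^2=-b(u'-A'v')(u'-B'v'),\qquad x'^2-ay'^2=-aC'^2u'v',$$ where $D'=a^{2h+1}b^{2h+1}\theta'^{g+1}-1$, $A'=a^{4h+3}\theta'^{2g+2}+bc^2d\,D'^2$, $B'=A'+2c\,D'^2$, $C'=a^{2h+1}\theta'^{g+1}-1$. Define $\mathbf{S}''\subset\mathbb{P}^4\times\mathbb{A}^1$, with coordinates $(x'':y'':z'':u'':v'')$ and $\theta''$, by the same two equations with double primes in place of primes, where $D''=a^{2h+1}b^{2h+1}-\theta''^{g+1}$, $A''=a^{4h+3}+bc^2d\,D''^2$, $B''=A''+2c\,D''^2$, $C''=a^{2h+1}-\theta''^{g+1}$. Glue the projections $\mathbf{S}'\to\mathbb{A}^1$ and $\mathbf{S}''\to\mathbb{A}^1$ over $\theta'\ne 0$, $\theta''\neq 0$ along $$\theta''=1/\theta',\quad (x'',y'',z'',u'')=\theta'^{-(2g+2)}(x',y',z',u'),\quad v''=v',$$ to a morphism $\tau:\mathbf{S}\to\mathbb{P}^1$ over $K$. Let $\mathbf{S}^{\mathrm{reg}}\subset\mathbf{S}$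 be the regular locus and let $\tau^{\mathrm{reg}}=\tau|_{\mathbf{S}^{\mathrm{reg}}}$. Assume that $g$ is odd, and let $\tilde\tau:\widetilde{\mathbf{S}}\to\mathbb{P}^1$ be any smooth compactification of $\tau^{\mathrm{reg}}$, i.e. $\widetilde{\mathbf{S}}$ is a smooth proper $K$-scheme containing $\mathbf{S}^{\mathrm{reg}}$ as a dense open subscheme and $\tilde\tau$ is a morphism over $K$ extending $\tau^{\mathrm{reg}}$. Then for every closed point $\theta\in\mathbb{P}^1$ with residue field $K(\theta)$ the fiber $\widetilde{\mathbf{S}}_\theta$ is split, i.e. it contains an open subscheme that is geometrically integral over $K(\theta)$. -/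

import Mathlib

universe u

namespace DP4Family

open CategoryTheory Limits AlgebraicGeometry

/-! ### Quotients of graded algebras by homogeneous ideals -/

section
open DirectSum
variable {R A : Type*} [CommRing R] [CommRing A] [Algebra R A] (𝒜 : ℕ → Submodule R A)

/-- The grading of `A ⧸ I` by the images of the graded pieces of `A`. -/
def quotientGrading (I : Ideal A) (n : ℕ) : Submodule R (A ⧸ I) :=
  (𝒜 n).map (Ideal.Quotient.mkₐ R I).toLinearMap

variable {𝒜}
theorem mk_mem_quotientGrading (I : Ideal A) {n : ℕ} {x : A} (hx : x ∈ 𝒜 n) :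
    Ideal.Quotient.mk I x ∈ quotientGrading 𝒜 I n := ⟨x, hx, rfl⟩

theorem quotientGrading_gradedMonoid [SetLike.GradedMonoid 𝒜] (I : Ideal A) :
    SetLike.GradedMonoid (quotientGrading 𝒜 I) where
  one_mem := ⟨1, SetLike.one_mem_graded 𝒜, map_one (Ideal.Quotient.mk I)⟩
  mul_mem := by
    rintro i j _ _ ⟨x, hx, rfl⟩ ⟨y, hy, rfl⟩
    exact ⟨x * y, SetLike.mul_mem_graded hx hy, map_mul (Ideal.Quotient.mk I) _ _⟩

noncomputable def quotientGradingAux [GradedAlgebra 𝒜] (I : Ideal A) :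
    A →ₗ[R] ⨁ n, quotientGrading 𝒜 I n :=
  (DFinsupp.mapRange.linearMap fun n =>
    ((Ideal.Quotient.mkₐ R I).toLinearMap.restrict
      (p := 𝒜 n) (q := quotientGrading 𝒜 I n) fun x hx => ⟨x, hx, rfl⟩)) ∘ₗ
    (decomposeLinearEquiv 𝒜).toLinearMap

theorem coe_quotientGradingAux [GradedAlgebra 𝒜] (I : Ideal A) (x : A) (n : ℕ) :
    (quotientGradingAux (𝒜 := 𝒜) I x n : A ⧸ I) = Ideal.Quotient.mk I (decompose 𝒜 x n) := rfl

theorem quotientGradingAux_ker [GradedAlgebra 𝒜] (I : Ideal A) (hI : I.IsHomogeneous 𝒜) :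
    I.restrictScalars R ≤ LinearMap.ker (quotientGradingAux (𝒜 := 𝒜) I) := fun x hx => by
  rw [LinearMap.mem_ker]
  refine DFinsupp.ext fun n => Subtype.ext ?_
  exact Ideal.Quotient.eq_zero_iff_mem.2 (hI n hx)

noncomputable def quotientDecompose [GradedAlgebra 𝒜] (I : Ideal A) (hI : I.IsHomogeneous 𝒜) :
    A ⧸ I →ₗ[R] ⨁ n, quotientGrading 𝒜 I n where
  toFun := Quotient.lift (s := Submodule.quotientRel I) (quotientGradingAux (𝒜 := 𝒜) I)
    fun x y hxy => by
      have h := quotientGradingAux_ker (𝒜 := 𝒜) I hI ((Submodule.quotientRel_def I).1 hxy)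
      rwa [LinearMap.mem_ker, map_sub, sub_eq_zero] at h
  map_add' := by
    intro x y
    obtain ⟨x, rfl⟩ := Ideal.Quotient.mk_surjective x
    obtain ⟨y, rfl⟩ := Ideal.Quotient.mk_surjective y
    exact map_add (quotientGradingAux (𝒜 := 𝒜) I) x y
  map_smul' := by
    intro r x
    obtain ⟨x, rfl⟩ := Ideal.Quotient.mk_surjective x
    exact map_smul (quotientGradingAux (𝒜 := 𝒜) I) r x

theorem quotientDecompose_mk [GradedAlgebra 𝒜] (I : Ideal A) (hI : I.IsHomogeneous 𝒜) (x : A) :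
    quotientDecompose I hI (Ideal.Quotient.mk I x) = quotientGradingAux (𝒜 := 𝒜) I x := rfl

/-- For a homogeneous ideal `I`, the images of the graded pieces make `A ⧸ I` a graded algebra. -/
noncomputable abbrev quotientGradedAlgebra [GradedAlgebra 𝒜] (I : Ideal A)
    (hI : I.IsHomogeneous 𝒜) : GradedAlgebra (quotientGrading 𝒜 I) where
  __ := quotientGrading_gradedMonoid I
  toDecomposition := Decomposition.ofLinearMap _ (quotientDecompose I hI)
    (by
      refine LinearMap.ext fun y => ?_
      obtain ⟨x, rfl⟩ := Ideal.Quotient.mk_surjective y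
      rw [LinearMap.comp_apply, quotientDecompose_mk, LinearMap.id_apply]
      induction x using Decomposition.inductionOn 𝒜 with
      | zero => simp
      | @homogeneous i m =>
        have : quotientGradingAux (𝒜 := 𝒜) I (m : A) = lof R ℕ (fun n => quotientGrading 𝒜 I n) i
            ⟨Ideal.Quotient.mk I m, mk_mem_quotientGrading I m.2⟩ := by
          ext n
          rw [coe_quotientGradingAux]
          by_cases h : i = n
          · subst h
            simp [lof_eq_of]
          · rw [decompose_of_mem_ne 𝒜 m.2 h, lof_eq_of, of_eq_of_ne _ _ _ (Ne.symm h)]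
            simp
        rw [this, coeLinearMap_lof]
      | add x y hx hy => rw [map_add, map_add, hx, hy, map_add])
    (by
      refine DirectSum.linearMap_ext _ fun i => LinearMap.ext fun y => ?_
      obtain ⟨_, x, hx, rfl⟩ := y
      simp only [LinearMap.comp_apply, LinearMap.id_apply, coeLinearMap_lof]
      change quotientDecompose I hI (Ideal.Quotient.mk I x) = _
      rw [quotientDecompose_mk]
      ext n
      rw [coe_quotientGradingAux]
      by_cases h : i = n
      · subst h
        rw [decompose_of_mem_same 𝒜 hx]; simp [lof_eq_of]
      · rw [decompose_of_mem_ne 𝒜 hx h, lof_eq_of, of_eq_of_ne _ _ _ (Ne.symm h)]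
        simp)
end

/-! ### Localising a graded ring at an element of degree zero is an open immersion on `Proj` -/

theorem isOpenImmersion_of_isLocalIso {X Y : Scheme} (f : X ⟶ Y) [h : IsLocalIso f]
    (hf : Function.Injective f) : IsOpenImmersion f := by
  have h3 : IsOpenMap f := by
    intro V hV
    rw [isOpen_iff_mem_nhds]
    rintro _ ⟨x, hx, rfl⟩
    obtain ⟨U, hxU, hU⟩ := h.exists_isOpenImmersion x
    have h5 := (U.ι ≫ f).isOpenEmbedding.isOpenMap (U.ι ⁻¹' V) (hV.preimage U.ι.continuous)
    refine Filter.mem_of_superset (h5.mem_nhds ⟨⟨x, hxU⟩, hx, rfl⟩) ?_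
    rintro _ ⟨y, hy, rfl⟩
    exact ⟨y.1, hy, rfl⟩
  refine IsOpenImmersion.iff_isIso_stalkMap.2
    ⟨.of_continuous_injective_isOpenMap f.continuous hf h3, fun x => ?_⟩
  obtain ⟨U, hxU, hU⟩ := h.exists_isOpenImmersion x
  obtain ⟨x, rfl⟩ : ∃ y : U.toScheme, U.ι y = x := ⟨⟨x, hxU⟩, rfl⟩
  have h4 := (IsOpenImmersion.iff_isIso_stalkMap.1 hU).2 x
  rw [Scheme.Hom.stalkMap_comp] at h4
  exact @IsIso.of_isIso_comp_right _ _ _ _ _ _ (U.ι.stalkMap x) inferInstance h4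

section
open HomogeneousLocalization Graded
variable {A B σ τ : Type u} [CommRing A] [SetLike σ A] [AddSubgroupClass σ A]
  [CommRing B] [SetLike τ B] [AddSubgroupClass τ B]
  {𝒜 : ℕ → σ} {ℬ : ℕ → τ} [GradedRing 𝒜] [GradedRing ℬ]
  (f : 𝒜 →+*ᵍ ℬ) (hf : HomogeneousIdeal.irrelevant ℬ ≤ (HomogeneousIdeal.irrelevant 𝒜).map f)

/-- The graded homomorphism `f` exhibits its target as the localisation of its source at the
powers of the degree zero element `s`. -/
structure IsGradedAway (s : A) : Prop where
  mem : s ∈ 𝒜 0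
  isUnit : ∃ r ∈ ℬ 0, f s * r = 1
  surj : ∀ i, ∀ b ∈ ℬ i, ∃ n : ℕ, ∃ x ∈ 𝒜 i, f s ^ n * b = f x
  inj : ∀ x, f x = 0 → ∃ n : ℕ, s ^ n * x = 0

variable {f} {s : A}

theorem IsGradedAway.isLocalization (h : IsGradedAway f s) {d : ℕ} (t : A) (ht : t ∈ 𝒜 d)
    (hs0 : s ∈ 𝒜 (0 • d)) :
    letI := (Away.map f t : Away 𝒜 t →+* Away ℬ (f t)).toAlgebra
    IsLocalization.Away (Away.mk 𝒜 ht 0 s hs0) (Away ℬ (f t)) := by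
  let := (Away.map f t : Away 𝒜 t →+* Away ℬ (f t)).toAlgebra
  have hval : ∀ k : ℕ, (Away.mk 𝒜 ht 0 s hs0 ^ k).val = Localization.mk (s ^ k) 1 := by
    intro k
    rw [HomogeneousLocalization.val_pow, Away.val_mk, Localization.mk_pow]
    congr 1
    ext; simp
  have hval' : ∀ k : ℕ, (Away.map f t (Away.mk 𝒜 ht 0 s hs0 ^ k)).val =
      Localization.mk (f s ^ k) 1 := by
    intro k
    rw [map_pow, HomogeneousLocalization.val_pow, Away.map_mk, Away.val_mk, Localization.mk_pow]
    congr 1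
    ext; simp
  refine IsLocalization.Away.mk _ ?_ ?_ ?_
  · obtain ⟨r, hr, hrs⟩ := h.isUnit
    refine IsUnit.of_mul_eq_one (Away.mk ℬ (f.2 ht) 0 r (by simpa using hr)) ?_
    have h1 := hval' 1
    rw [pow_one, pow_one] at h1
    rw [← HomogeneousLocalization.val_injective _ |>.eq_iff, HomogeneousLocalization.val_mul]
    change (Away.map f t (Away.mk 𝒜 ht 0 s hs0)).val * _ = _
    rw [h1, Away.val_mk, Localization.mk_mul, hrs, HomogeneousLocalization.val_one,
      ← Localization.mk_one]
    congr 1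
    ext; simp
  · intro z
    obtain ⟨n, b, hb, rfl⟩ := Away.mk_surjective ℬ (f.2 ht) z
    obtain ⟨k, x, hx, hk⟩ := h.surj _ _ hb
    refine ⟨k, Away.mk 𝒜 ht n x hx, ?_⟩
    rw [← map_pow]
    change _ * Away.map f t _ = Away.map f t _
    rw [← HomogeneousLocalization.val_injective _ |>.eq_iff, HomogeneousLocalization.val_mul,
      hval', Away.map_mk, Away.val_mk, Away.val_mk, Localization.mk_mul, mul_comm b, hk]
    congr 1
    ext; simp
  · intro x y hxy
    obtain ⟨z, hz⟩ : ∃ z, z = x - y := ⟨_, rfl⟩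
    have hz0 : Away.map f t z = 0 := by rw [hz, map_sub, sub_eq_zero]; exact hxy
    obtain ⟨n, a, ha, rfl⟩ := Away.mk_surjective 𝒜 ht z
    rw [Away.map_mk, ← HomogeneousLocalization.val_injective _ |>.eq_iff, Away.val_mk,
      HomogeneousLocalization.val_zero, Localization.mk_eq_mk', IsLocalization.mk'_eq_zero_iff]
      at hz0
    obtain ⟨⟨_, k, rfl⟩, hk⟩ := hz0
    obtain ⟨m, hm⟩ := h.inj (t ^ k * a) (by rw [map_mul, map_pow]; exact hk)
    refine ⟨m, ?_⟩
    rw [← sub_eq_zero, ← mul_sub, ← hz, ← HomogeneousLocalization.val_injective _ |>.eq_iff,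
      HomogeneousLocalization.val_mul, hval, Away.val_mk, HomogeneousLocalization.val_zero,
      Localization.mk_mul, Localization.mk_eq_mk', IsLocalization.mk'_eq_zero_iff]
    exact ⟨⟨t ^ k, k, rfl⟩, by rw [← hm]; ring⟩

theorem IsGradedAway.isOpenImmersion_SpecMap (h : IsGradedAway f s) {d : ℕ} (t : A) (ht : t ∈ 𝒜 d) :
    IsOpenImmersion (Spec.map (CommRingCat.ofHom (Away.map f t : Away 𝒜 t →+* Away ℬ (f t)))) := by
  let := (Away.map f t : Away 𝒜 t →+* Away ℬ (f t)).toAlgebra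
  have := h.isLocalization t ht (by simpa using h.mem)
  exact IsOpenImmersion.of_isLocalization (S := Away ℬ (f t)) (Away.mk 𝒜 ht 0 s _)

theorem IsGradedAway.injective (h : IsGradedAway f s)
    : Function.Injective (ProjectiveSpectrum.comap f hf) := by
  have key : ∀ p q : ProjectiveSpectrum ℬ,
      ProjectiveSpectrum.comap f hf p = ProjectiveSpectrum.comap f hf q →
      p.asHomogeneousIdeal ≤ q.asHomogeneousIdeal := by
    intro p q hpq b hb
    classical
    rw [← DirectSum.sum_support_decompose ℬ b]
    refine sum_mem fun i _ => ?_
    obtain ⟨n, x, hx, hn⟩ := h.surj i _ (SetLike.coe_mem (DirectSum.decompose ℬ b i))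
    have h1 : f x ∈ p.asHomogeneousIdeal := by
      rw [← hn]
      exact Ideal.mul_mem_left _ _ (p.asHomogeneousIdeal.2 i hb)
    have h2 : x ∈ (ProjectiveSpectrum.comap f hf p).asHomogeneousIdeal := h1
    rw [hpq] at h2
    have h3 : f x ∈ q.asHomogeneousIdeal := h2
    rw [← hn] at h3
    obtain ⟨r, -, hr⟩ := h.isUnit
    have := Ideal.mul_mem_left q.asHomogeneousIdeal.toIdeal (r ^ n) h3
    rwa [← mul_assoc, ← mul_pow, mul_comm r, hr, one_pow, one_mul] at this
  intro p q hpq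
  exact ProjectiveSpectrum.ext (le_antisymm (key p q hpq) (key q p hpq.symm))

theorem IsGradedAway.isOpenImmersion_awayι (h : IsGradedAway f s)
    {d : ℕ} (hd : 0 < d) (t : A) (ht : t ∈ 𝒜 d) :
    IsOpenImmersion (Proj.awayι ℬ (f t) (f.2 ht) hd ≫ Proj.map f hf) := by
  rw [Proj.awayι_comp_map f hf hd t ht]
  have := h.isOpenImmersion_SpecMap t ht
  infer_instance

theorem IsGradedAway.isOpenImmersion (h : IsGradedAway f s) : IsOpenImmersion (Proj.map f hf) := by
  have h1 : IsLocalIso (Proj.map f hf) := by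
    rw [IsZariskiLocalAtSource.iff_of_openCover (P := @IsLocalIso)
      (Proj.mapAffineOpenCover f hf).openCover]
    intro i
    have : IsOpenImmersion ((Proj.mapAffineOpenCover f hf).openCover.f i ≫ Proj.map f hf) :=
      h.isOpenImmersion_awayι hf i.1.2 _ i.2.2
    rw [isLocalIso_iff]
    exact fun x => ⟨⊤, trivial, inferInstance⟩
  exact isOpenImmersion_of_isLocalIso _ (h.injective hf)
end

section
open MvPolynomial HomogeneousLocalization Graded
variable {R R' : Type u} [CommRing R] [CommRing R']

/-! ### Families of intersections of two quadrics in `ℙ⁴` -/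

/-- The homomorphism `R[x,y,z,u,v] → R'[x,y,z,u,v]` that is `φ` on coefficients and multiplies
the `i`-th variable by `w i`. -/
noncomputable def coordChange (φ : R →+* R') (w : Fin 5 → R') :
    MvPolynomial (Fin 5) R →+* MvPolynomial (Fin 5) R' :=
  eval₂Hom (C.comp φ) fun i => C (w i) * X i

variable (φ : R →+* R') (w : Fin 5 → R')

theorem coordChange_C (r : R) : coordChange φ w (C r) = C (φ r) := by simp [coordChange]

theorem coordChange_X (i : Fin 5) : coordChange φ w (X i) = C (w i) * X i := by simp [coordChange]

theorem coordChange_monomial (m : Fin 5 →₀ ℕ) (r : R) :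
    coordChange φ w (monomial m r) = monomial m (φ r * m.prod fun i n => w i ^ n) := by
  rw [monomial_eq, monomial_eq, coordChange, coe_eval₂Hom, eval₂_mul, eval₂_C, Finsupp.prod,
    eval₂_prod, map_mul, mul_assoc]
  congr 1
  simp only [eval₂_pow, eval₂_X, mul_pow, Finset.prod_mul_distrib, Finsupp.prod, map_prod, map_pow]

theorem coeff_coordChange (m : Fin 5 →₀ ℕ) (p : MvPolynomial (Fin 5) R) :
    coeff m (coordChange φ w p) = φ (coeff m p) * m.prod fun i n => w i ^ n := by
  classical
  induction p using MvPolynomial.induction_on' with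
  | monomial n r =>
    rw [coordChange_monomial, coeff_monomial, coeff_monomial]
    split_ifs with h
    · rw [h]
    · simp
  | add p q hp hq => rw [map_add, coeff_add, coeff_add, hp, hq, map_add, add_mul]

theorem coordChange_isHomogeneous {n : ℕ} {p : MvPolynomial (Fin 5) R} (hp : p.IsHomogeneous n) :
    (coordChange φ w p).IsHomogeneous n := by
  intro m hm
  refine hp (d := m) fun h0 => hm ?_
  rw [coeff_coordChange, h0, map_zero, zero_mul]

variable {φ w} {s : R}

theorem coordChange_surj (hw : ∀ i, IsUnit (w i)) (hφ : @IsLocalization.Away R _ s R' _ φ.toAlgebra)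
    {n : ℕ} {q : MvPolynomial (Fin 5) R'} (hq : q.IsHomogeneous n) :
    ∃ k : ℕ, ∃ p : MvPolynomial (Fin 5) R, p.IsHomogeneous n ∧
      coordChange φ w (C s) ^ k * q = coordChange φ w p := by
  let : Algebra R R' := φ.toAlgebra
  have hmon : ∀ (m : Fin 5 →₀ ℕ) (r : R'), ∃ k : ℕ, ∃ r₀ : R,
      coordChange φ w (C s) ^ k * monomial m r = coordChange φ w (monomial m r₀) := by
    intro m r
    have hu : IsUnit (m.prod fun i n => w i ^ n) :=
      IsUnit.prod_iff.2 fun i _ => (hw i).pow _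
    obtain ⟨v, hv⟩ := hu.exists_left_inv
    obtain ⟨k, r₀, hr⟩ := IsLocalization.Away.surj s (r * v)
    refine ⟨k, r₀, ?_⟩
    have hr' : r * v * φ s ^ k = φ r₀ := hr
    rw [coordChange_monomial, ← hr', coordChange_C, ← map_pow, C_mul_monomial]
    congr 1
    linear_combination (- r * φ s ^ k) * hv
  rw [← support_sum_monomial_coeff q]
  have : ∀ T : Finset (Fin 5 →₀ ℕ), T ⊆ q.support → ∃ k : ℕ, ∃ p : MvPolynomial (Fin 5) R,
      p.IsHomogeneous n ∧ coordChange φ w (C s) ^ k * ∑ v ∈ T, monomial v (coeff v q) =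
        coordChange φ w p := by
    classical
    intro T
    induction T using Finset.induction_on with
    | empty => exact fun _ => ⟨0, 0, isHomogeneous_zero _ _ _, by simp⟩
    | insert m T hm ih =>
      intro hT
      obtain ⟨k, p, hp, hk⟩ := ih fun x hx => hT (Finset.mem_insert_of_mem hx)
      obtain ⟨l, r, hl⟩ := hmon m (coeff m q)
      have hmn : m.degree = n := by
        have := hq (mem_support_iff.1 (hT (Finset.mem_insert_self m T)))
        rw [Finsupp.degree_eq_weight_one]
        exact this
      refine ⟨k + l, C s ^ k * monomial m r + C s ^ l * p, ?_, ?_⟩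
      · refine IsHomogeneous.add ?_ ?_
        · rw [← map_pow, C_mul_monomial]
          exact isHomogeneous_monomial _ hmn
        · rw [← map_pow]
          exact hp.C_mul _
      · rw [Finset.sum_insert hm, map_add, map_mul, map_mul, map_pow, map_pow, ← hk, ← hl]
        ring
  exact this _ subset_rfl

theorem coordChange_inj (hw : ∀ i, IsUnit (w i)) (hφ : @IsLocalization.Away R _ s R' _ φ.toAlgebra)
    {p : MvPolynomial (Fin 5) R} (hp : coordChange φ w p = 0) : ∃ k : ℕ, C s ^ k * p = 0 := by
  let : Algebra R R' := φ.toAlgebra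
  have hco : ∀ m, ∃ k : ℕ, s ^ k * coeff m p = 0 := by
    intro m
    have hu : IsUnit (m.prod fun i n => w i ^ n) :=
      IsUnit.prod_iff.2 fun i _ => (hw i).pow _
    have h1 : φ (coeff m p) = 0 := by
      have := coeff_coordChange φ w m p
      rw [hp, coeff_zero] at this
      exact (hu.mul_left_eq_zero).1 this.symm
    obtain ⟨k, hk⟩ := IsLocalization.Away.exists_of_eq (S := R') s
      (show algebraMap R R' (coeff m p) = algebraMap R R' 0 by rw [map_zero]; exact h1)
    exact ⟨k, by simpa using hk⟩
  choose k hk using hco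
  refine ⟨∑ m ∈ p.support, k m, ?_⟩
  ext m
  rw [← map_pow, coeff_C_mul, coeff_zero]
  by_cases hm : m ∈ p.support
  · rw [← Finset.sum_erase_add _ _ hm, pow_add, mul_assoc, hk, mul_zero]
  · rw [notMem_support_iff.1 hm, mul_zero]

theorem coordChange_mem_map (hw : ∀ i, IsUnit (w i))
    (hφ : @IsLocalization.Away R _ s R' _ φ.toAlgebra) (I : Ideal (MvPolynomial (Fin 5) R))
    {p : MvPolynomial (Fin 5) R} (hp : coordChange φ w p ∈ I.map (coordChange φ w)) :
    ∃ k : ℕ, C s ^ k * p ∈ I := by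
  have key : ∀ q ∈ I.map (coordChange φ w), ∃ k : ℕ, ∃ x ∈ I,
      coordChange φ w (C s) ^ k * q = coordChange φ w x := by
    intro q hq
    induction hq using Submodule.span_induction with
    | mem q hq =>
      obtain ⟨x, hx, rfl⟩ := hq
      exact ⟨0, x, hx, by simp⟩
    | zero => exact ⟨0, 0, I.zero_mem, by simp⟩
    | add q q' _ _ h h' =>
      obtain ⟨k, x, hx, hk⟩ := h
      obtain ⟨l, y, hy, hl⟩ := h'
      refine ⟨k + l, C s ^ l * x + C s ^ k * y,
        I.add_mem (I.mul_mem_left _ hx) (I.mul_mem_left _ hy), ?_⟩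
      rw [map_add, map_mul, map_mul, map_pow, map_pow, ← hk, ← hl]
      ring
    | smul c q _ h =>
      obtain ⟨k, x, hx, hk⟩ := h
      have hc : ∃ l : ℕ, ∃ y, coordChange φ w (C s) ^ l * c = coordChange φ w y := by
        rw [← sum_homogeneousComponent c]
        generalize Finset.range (c.totalDegree + 1) = T
        classical
        induction T using Finset.induction_on with
        | empty => exact ⟨0, 0, by simp⟩
        | insert m T hm ih =>
          obtain ⟨k, p, hk⟩ := ih
          obtain ⟨l, r, -, hl⟩ :=
            coordChange_surj hw hφ (homogeneousComponent_isHomogeneous m c)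
          refine ⟨k + l, C s ^ k * r + C s ^ l * p, ?_⟩
          rw [Finset.sum_insert hm, map_add, map_mul, map_mul, map_pow, map_pow, ← hk, ← hl]
          ring
      obtain ⟨l, y, hl⟩ := hc
      refine ⟨l + k, y * x, I.mul_mem_left _ hx, ?_⟩
      rw [map_mul, ← hk, ← hl, smul_eq_mul]
      ring
  obtain ⟨k, x, hx, hk⟩ := key _ hp
  rw [← map_pow, ← map_mul, ← sub_eq_zero, ← map_sub] at hk
  obtain ⟨l, hl⟩ := coordChange_inj hw hφ hk
  refine ⟨l + k, ?_⟩
  rw [mul_sub, sub_eq_zero, ← mul_assoc, ← pow_add] at hl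
  rw [hl]
  exact I.mul_mem_left _ hx

attribute [local instance] MvPolynomial.gradedAlgebra

/-- The grading by degree on `R[x,y,z,u,v] ⧸ I`. -/
noncomputable abbrev coordGrading (I : Ideal (MvPolynomial (Fin 5) R)) :
    ℕ → Submodule R (MvPolynomial (Fin 5) R ⧸ I) :=
  quotientGrading (homogeneousSubmodule (Fin 5) R) I

/-- The constants `a, b, A, B, C` in a ring `R` that enter the equations of a family of surfaces
over `Spec R`. -/
structure SurfaceCoeffs (R : Type u) where
  (a b cA cB cC : R)

namespace SurfaceCoeffs

variable (P : SurfaceCoeffs R) (P' : SurfaceCoeffs R')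

/-- `x² - a z² + b (u - A v) (u - B v)`; the variables `0, 1, 2, 3, 4` are `x, y, z, u, v`. -/
noncomputable def quadric₁ : MvPolynomial (Fin 5) R :=
  X 0 ^ 2 - C P.a * X 2 ^ 2 + C P.b * (X 3 - C P.cA * X 4) * (X 3 - C P.cB * X 4)

/-- `x² - a y² + a C² u v`. -/
noncomputable def quadric₂ : MvPolynomial (Fin 5) R :=
  X 0 ^ 2 - C P.a * X 1 ^ 2 + C (P.a * P.cC ^ 2) * X 3 * X 4

/-- The ideal of the surface. -/
noncomputable def ideal : Ideal (MvPolynomial (Fin 5) R) := Ideal.span {P.quadric₁, P.quadric₂}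

theorem ideal_isHomogeneous : P.ideal.IsHomogeneous (homogeneousSubmodule (Fin 5) R) := by
  have hX : ∀ i : Fin 5, (X i : MvPolynomial (Fin 5) R).IsHomogeneous 1 := isHomogeneous_X R
  refine Ideal.homogeneous_span _ _ ?_
  rintro _ (rfl | rfl) <;> refine ⟨2, (mem_homogeneousSubmodule _ _).2 ?_⟩
  · refine (((hX 0).pow 2).sub (((hX 2).pow 2).C_mul _)).add ?_
    rw [mul_assoc]
    exact (((hX 3).sub ((hX 4).C_mul _)).mul ((hX 3).sub ((hX 4).C_mul _))).C_mul _
  · refine (((hX 0).pow 2).sub (((hX 1).pow 2).C_mul _)).add ?_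
    rw [mul_assoc]
    exact ((hX 3).mul (hX 4)).C_mul _

noncomputable instance : GradedAlgebra (coordGrading P.ideal) :=
  quotientGradedAlgebra _ P.ideal_isHomogeneous

/-- The closed subscheme `x² - a z² = -b (u - A v) (u - B v)`, `x² - a y² = -a C² u v` of `ℙ⁴` over
`Spec R`, as the `Proj` of its homogeneous coordinate ring. -/
noncomputable abbrev surface : Scheme.{u} := Proj (coordGrading P.ideal)

/-- The projection to the base. -/
noncomputable def toSpec : P.surface ⟶ Spec (.of R) :=
  Proj.toSpecZero (coordGrading P.ideal) ≫
    Spec.map (CommRingCat.ofHom (algebraMap R (coordGrading P.ideal 0)))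

/-- Along `φ` and the substitution `(x, y, z, u, v) ↦ (l x, l y, l z, l u, v)` with a unit `l`, the
equations with constants `P` become those with constants `P'`. -/
structure Compat (φ : R →+* R') (l : R') : Prop where
  isUnit : IsUnit l
  a : φ P.a = P'.a
  b : φ P.b = P'.b
  cA : φ P.cA = l * P'.cA
  cB : φ P.cB = l * P'.cB
  cC : φ P.cC ^ 2 = l * P'.cC ^ 2

variable {P P'} {l : R'}

theorem Compat.map_ideal (h : P.Compat P' φ l)
    : P.ideal.map (coordChange φ ![l, l, l, l, 1]) = P'.ideal := by
  have hu : IsUnit (MvPolynomial.C (l ^ 2) : MvPolynomial (Fin 5) R') := (h.isUnit.pow 2).map _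
  have h1 : coordChange φ ![l, l, l, l, 1] P.quadric₁ = MvPolynomial.C (l ^ 2) * P'.quadric₁ := by
    simp only [quadric₁, map_add, map_sub, map_mul, map_pow, coordChange_C, coordChange_X, h.a,
      h.b, h.cA, h.cB]
    simp
    ring
  have h2 : coordChange φ ![l, l, l, l, 1] P.quadric₂ = MvPolynomial.C (l ^ 2) * P'.quadric₂ := by
    have hC := congrArg (MvPolynomial.C (σ := Fin 5)) h.cC
    simp only [quadric₂, map_add, map_sub, map_mul, map_pow, coordChange_C, coordChange_X, h.a]
      at hC ⊢
    rw [hC]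
    simp
    ring
  rw [ideal, ideal, Ideal.map_span, Set.image_pair, h1, h2, Ideal.span_insert, Ideal.span_insert]
  rw [Ideal.span_singleton_mul_left_unit hu, Ideal.span_singleton_mul_left_unit hu]

/-- The map of homogeneous coordinate rings `(x, y, z, u, v) ↦ (l x, l y, l z, l u, v)`. -/
noncomputable def Compat.gradedHom (h : P.Compat P' φ l)
    : coordGrading P.ideal →+*ᵍ coordGrading P'.ideal where
  toRingHom := Ideal.quotientMap P'.ideal (coordChange φ ![l, l, l, l, 1])
    (Ideal.map_le_iff_le_comap.1 h.map_ideal.le)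
  map_mem := by
    rintro n _ ⟨p, hp, rfl⟩
    exact ⟨coordChange φ ![l, l, l, l, 1] p, coordChange_isHomogeneous φ _ hp, rfl⟩

theorem Compat.gradedHom_mk (h : P.Compat P' φ l) (p : MvPolynomial (Fin 5) R) :
    h.gradedHom (Ideal.Quotient.mk _ p) =
      Ideal.Quotient.mk _ (coordChange φ ![l, l, l, l, 1] p) := rfl

theorem Compat.isUnit_weights (h : P.Compat P' φ l) (i : Fin 5)
    : IsUnit ((![l, l, l, l, 1] : Fin 5 → R') i) := by
  fin_cases i <;> simp [h.isUnit]

theorem Compat.irrelevant_le (h : P.Compat P' φ l)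
    : HomogeneousIdeal.irrelevant (coordGrading P'.ideal) ≤
    (HomogeneousIdeal.irrelevant (coordGrading P.ideal)).map h.gradedHom := by
  refine (HomogeneousIdeal.irrelevant_le _).2 ?_
  rintro n hn _ ⟨q, hq, rfl⟩
  have hX : ∀ i : Fin 5, Ideal.Quotient.mk P'.ideal (X i) ∈
      ((HomogeneousIdeal.irrelevant (coordGrading P.ideal)).map h.gradedHom).toIdeal := by
    intro i
    obtain ⟨v, hv⟩ := (h.isUnit_weights i).exists_left_inv
    have h1 : h.gradedHom (Ideal.Quotient.mk P.ideal (X i)) ∈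
        ((HomogeneousIdeal.irrelevant (coordGrading P.ideal)).map h.gradedHom).toIdeal :=
      Ideal.mem_map_of_mem _ (HomogeneousIdeal.mem_irrelevant_of_mem _ one_pos
        (mk_mem_quotientGrading _ (isHomogeneous_X R i)))
    have h2 := Ideal.mul_mem_left _ (Ideal.Quotient.mk P'.ideal (MvPolynomial.C v)) h1
    rwa [h.gradedHom_mk, coordChange_X, ← map_mul, ← mul_assoc, ← map_mul, hv, map_one,
      one_mul] at h2
  have hq' : q ∈ Ideal.span (X '' (Set.univ : Set (Fin 5))) := by
    rw [mem_ideal_span_X_image]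
    intro m hm
    by_contra! h0
    have hm0 : m = 0 := Finsupp.ext fun i => h0 i trivial
    have := (hq : q.IsHomogeneous n) (mem_support_iff.1 hm)
    rw [hm0, map_zero] at this
    exact hn.ne this
  have h3 := Ideal.mem_map_of_mem (Ideal.Quotient.mk P'.ideal) hq'
  rw [Ideal.map_span] at h3
  refine Ideal.span_le.2 ?_ h3
  rintro _ ⟨_, ⟨i, -, rfl⟩, rfl⟩
  exact hX i

/-- The morphism of surfaces over `φ` with `(x, y, z, u, v) ↦ (l x : l y : l z : l u : v)`. -/
noncomputable def Compat.map (h : P.Compat P' φ l)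
    : P'.surface ⟶ P.surface := Proj.map h.gradedHom h.irrelevant_le

theorem Compat.awayι_map_toSpec (h : P.Compat P' φ l) {d : ℕ} (hd : 0 < d)
    (t : MvPolynomial (Fin 5) R ⧸ P.ideal)
    (ht : t ∈ coordGrading P.ideal d) :
    Proj.awayι (coordGrading P'.ideal) (h.gradedHom t) (h.gradedHom.2 ht) hd ≫ h.map ≫ P.toSpec =
      Proj.awayι (coordGrading P'.ideal) (h.gradedHom t) (h.gradedHom.2 ht) hd ≫ P'.toSpec ≫
        Spec.map (CommRingCat.ofHom φ) := by
  rw [map, toSpec, toSpec, Proj.awayι_comp_map_assoc _ _ hd t ht, Proj.awayι_toSpecZero_assoc,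
    Category.assoc, Proj.awayι_toSpecZero_assoc]
  simp only [← Spec.map_comp, ← CommRingCat.ofHom_comp]
  refine congrArg Spec.map ?_
  refine CommRingCat.hom_ext (RingHom.ext fun r => ?_)
  refine HomogeneousLocalization.val_injective _ ?_
  change Localization.mk (h.gradedHom (algebraMap R _ r)) _ =
    Localization.mk (algebraMap R' _ (φ r)) _
  have h1 : h.gradedHom (algebraMap R _ r) = algebraMap R' _ (φ r) := by
    change Ideal.Quotient.mk _ (coordChange φ ![l, l, l, l, 1] (MvPolynomial.C r)) = _
    rw [coordChange_C]
    rfl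
  rw [h1]
  congr 1
  exact Subtype.ext (map_one h.gradedHom)

theorem Compat.map_toSpec (h : P.Compat P' φ l)
    : h.map ≫ P.toSpec = P'.toSpec ≫ Spec.map (CommRingCat.ofHom φ) := by
  refine (Proj.mapAffineOpenCover h.gradedHom h.irrelevant_le).openCover.hom_ext _ _ fun i => ?_
  exact h.awayι_map_toSpec i.1.2 _ i.2.2

theorem Compat.isGradedAway (h : P.Compat P' φ l)
    (hφ : @IsLocalization.Away R _ s R' _ φ.toAlgebra) :
    IsGradedAway h.gradedHom (Ideal.Quotient.mk _ (MvPolynomial.C s)) where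
  mem := mk_mem_quotientGrading _ (isHomogeneous_C _ _)
  isUnit := by
    let : Algebra R R' := φ.toAlgebra
    obtain ⟨r, hr⟩ := (IsLocalization.Away.algebraMap_isUnit (S := R') s).exists_right_inv
    refine ⟨Ideal.Quotient.mk _ (MvPolynomial.C r),
      mk_mem_quotientGrading _ (isHomogeneous_C _ _), ?_⟩
    have hr' : φ s * r = 1 := hr
    rw [h.gradedHom_mk, coordChange_C, ← map_mul, ← map_mul, hr', map_one, map_one]
  surj := by
    rintro n _ ⟨q, hq, rfl⟩
    obtain ⟨k, p, hp, hk⟩ := coordChange_surj h.isUnit_weights hφ hq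
    refine ⟨k, Ideal.Quotient.mk _ p, mk_mem_quotientGrading _ hp, ?_⟩
    rw [h.gradedHom_mk, h.gradedHom_mk, ← hk, map_mul, map_pow]
    rfl
  inj := by
    intro x hx
    obtain ⟨p, rfl⟩ := Ideal.Quotient.mk_surjective x
    rw [h.gradedHom_mk, Ideal.Quotient.eq_zero_iff_mem, ← h.map_ideal] at hx
    obtain ⟨k, hk⟩ := coordChange_mem_map h.isUnit_weights hφ _ hx
    exact ⟨k, by rwa [← map_pow, ← map_mul, Ideal.Quotient.eq_zero_iff_mem]⟩

theorem Compat.isOpenImmersion_map (h : P.Compat P' φ l)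
    (hφ : @IsLocalization.Away R _ s R' _ φ.toAlgebra) :
    IsOpenImmersion h.map := (h.isGradedAway hφ).isOpenImmersion h.irrelevant_le

end SurfaceCoeffs
end

/-! ### The projective line -/

section
open Polynomial
variable (K : Type u) [Field K]

/-- `K[θ'] → K[T, T⁻¹]`, `θ' ↦ T`. -/
noncomputable def zeroIncl : K[X] →+* LaurentPolynomial K := Polynomial.toLaurent

/-- `K[θ''] → K[T, T⁻¹]`, `θ'' ↦ T⁻¹`. -/
noncomputable def inftyIncl : K[X] →+* LaurentPolynomial K :=
  (LaurentPolynomial.invert (R := K)).toRingEquiv.toRingHom.comp Polynomial.toLaurent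

theorem isLocalization_zeroIncl :
    @IsLocalization.Away K[X] _ X (LaurentPolynomial K) _ (zeroIncl K).toAlgebra :=
  LaurentPolynomial.isLocalization

theorem isLocalization_inftyIncl :
    @IsLocalization.Away K[X] _ X (LaurentPolynomial K) _ (inftyIncl K).toAlgebra :=
  (IsLocalization.isLocalization_iff_of_ringEquiv (Submonoid.powers (X : K[X]))
    (LaurentPolynomial.invert (R := K)).toRingEquiv).1 LaurentPolynomial.isLocalization

instance isOpenImmersion_zeroIncl :
    IsOpenImmersion (Spec.map (CommRingCat.ofHom (zeroIncl K))) := by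
  let : Algebra K[X] (LaurentPolynomial K) := (zeroIncl K).toAlgebra
  have := isLocalization_zeroIncl K
  exact IsOpenImmersion.of_isLocalization (X : K[X])

instance isOpenImmersion_inftyIncl :
    IsOpenImmersion (Spec.map (CommRingCat.ofHom (inftyIncl K))) := by
  let : Algebra K[X] (LaurentPolynomial K) := (inftyIncl K).toAlgebra
  have := isLocalization_inftyIncl K
  exact IsOpenImmersion.of_isLocalization (X : K[X])

/-- The projective line over `K`: two affine lines with coordinates `θ'` and `θ''`, glued along
`θ'' = 1 / θ'`. -/
noncomputable def P1 : Scheme.{u} :=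
  pushout (Spec.map (CommRingCat.ofHom (zeroIncl K))) (Spec.map (CommRingCat.ofHom (inftyIncl K)))

namespace P1

/-- The affine line with coordinate `θ'` in `ℙ¹`. -/
noncomputable def zeroChart : Spec (.of K[X]) ⟶ P1 K := pushout.inl _ _

/-- The affine line with coordinate `θ''` in `ℙ¹`. -/
noncomputable def inftyChart : Spec (.of K[X]) ⟶ P1 K := pushout.inr _ _

theorem condition : Spec.map (CommRingCat.ofHom (zeroIncl K)) ≫ zeroChart K =
    Spec.map (CommRingCat.ofHom (inftyIncl K)) ≫ inftyChart K := pushout.condition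

/-- The structure morphism of `ℙ¹`. -/
noncomputable def toSpec : P1 K ⟶ Spec (.of K) :=
  pushout.desc (Spec.map (CommRingCat.ofHom Polynomial.C))
    (Spec.map (CommRingCat.ofHom Polynomial.C)) <| by
      rw [← Spec.map_comp, ← Spec.map_comp, ← CommRingCat.ofHom_comp, ← CommRingCat.ofHom_comp]
      congr 2
      ext r
      simp [zeroIncl, inftyIncl]

end P1
end

/-! ### The family of surfaces -/

section
open Polynomial
variable {K : Type u} [Field K] (h g : ℕ) (a b c d : K)

/-- `D = a^(2h+1) b^(2h+1) θ'^(g+1) - 1`. -/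
noncomputable def polyD₀ : K[X] := C (a ^ (2 * h + 1) * b ^ (2 * h + 1)) * X ^ (g + 1) - 1

/-- The constants of the family over the affine line with coordinate `θ'`:
`A = a^(4h+3) θ'^(2g+2) + b c² d D²`, `B = a^(4h+3) θ'^(2g+2) + (b c² d + 2 c) D²`,
`C = a^(2h+1) θ'^(g+1) - 1`. -/
noncomputable def zeroCoeffs : SurfaceCoeffs K[X] where
  a := C a
  b := C b
  cA := C (a ^ (4 * h + 3)) * X ^ (2 * g + 2) + C (b * c ^ 2 * d) * polyD₀ h g a b ^ 2
  cB := C (a ^ (4 * h + 3)) * X ^ (2 * g + 2) + C (b * c ^ 2 * d + 2 * c) * polyD₀ h g a b ^ 2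
  cC := C (a ^ (2 * h + 1)) * X ^ (g + 1) - 1

/-- `D = a^(2h+1) b^(2h+1) - θ''^(g+1)`. -/
noncomputable def polyD₁ : K[X] := C (a ^ (2 * h + 1) * b ^ (2 * h + 1)) - X ^ (g + 1)

/-- The constants of the family over the affine line with coordinate `θ''`:
`A = a^(4h+3) + b c² d D²`, `B = a^(4h+3) + (b c² d + 2 c) D²`, `C = a^(2h+1) - θ''^(g+1)`. -/
noncomputable def inftyCoeffs : SurfaceCoeffs K[X] where
  a := C a
  b := C b
  cA := C (a ^ (4 * h + 3)) + C (b * c ^ 2 * d) * polyD₁ h g a b ^ 2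
  cB := C (a ^ (4 * h + 3)) + C (b * c ^ 2 * d + 2 * c) * polyD₁ h g a b ^ 2
  cC := C (a ^ (2 * h + 1)) - X ^ (g + 1)

/-- The constants `zeroCoeffs` over the overlap `θ' ≠ 0`. -/
noncomputable def overlapCoeffs : SurfaceCoeffs (LaurentPolynomial K) where
  a := zeroIncl K (zeroCoeffs h g a b c d).a
  b := zeroIncl K (zeroCoeffs h g a b c d).b
  cA := zeroIncl K (zeroCoeffs h g a b c d).cA
  cB := zeroIncl K (zeroCoeffs h g a b c d).cB
  cC := zeroIncl K (zeroCoeffs h g a b c d).cC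

theorem zero_compat :
    (zeroCoeffs h g a b c d).Compat (overlapCoeffs h g a b c d) (zeroIncl K) 1 where
  isUnit := isUnit_one
  a := rfl
  b := rfl
  cA := (one_mul _).symm
  cB := (one_mul _).symm
  cC := (one_mul _).symm

theorem zeroIncl_C (r : K) : zeroIncl K (C r) = LaurentPolynomial.C r := by simp [zeroIncl]

theorem inftyIncl_C (r : K) : inftyIncl K (C r) = LaurentPolynomial.C r := by simp [inftyIncl]

theorem zeroIncl_X : zeroIncl K X = LaurentPolynomial.T 1 := by simp [zeroIncl]

theorem inftyIncl_X : inftyIncl K X = LaurentPolynomial.T (-1) := by simp [inftyIncl]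

theorem T_neg_mul (n : ℕ) :
    (LaurentPolynomial.T (-1) : LaurentPolynomial K) ^ n * LaurentPolynomial.T 1 ^ n = 1 := by
  rw [← mul_pow, ← LaurentPolynomial.T_add, neg_add_cancel, LaurentPolynomial.T_zero, one_pow]

/-- On the overlap `θ'' = 1 / θ'` one has `x'' = x' / θ'^(2g+2)`, and likewise for `y, z, u`, while
`v'' = v'`. -/
theorem infty_compat :
    (inftyCoeffs h g a b c d).Compat (overlapCoeffs h g a b c d) (inftyIncl K)
      (LaurentPolynomial.T (-1) ^ (2 * g + 2)) where
  isUnit := (LaurentPolynomial.isUnit_T _).pow _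
  a := by simp only [inftyCoeffs, overlapCoeffs, zeroCoeffs, zeroIncl_C, inftyIncl_C]
  b := by simp only [inftyCoeffs, overlapCoeffs, zeroCoeffs, zeroIncl_C, inftyIncl_C]
  cA := by
    have h1 := T_neg_mul (K := K) (g + 1)
    have h2 : (LaurentPolynomial.T (-1) : LaurentPolynomial K) ^ (2 * g + 2) =
        (LaurentPolynomial.T (-1) ^ (g + 1)) ^ 2 := by ring
    have h3 : (LaurentPolynomial.T 1 : LaurentPolynomial K) ^ (2 * g + 2) =
        (LaurentPolynomial.T 1 ^ (g + 1)) ^ 2 := by ring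
    simp only [inftyCoeffs, overlapCoeffs, zeroCoeffs, polyD₀, polyD₁, map_add, map_mul, map_sub,
      map_pow, map_one, zeroIncl_C, inftyIncl_C, zeroIncl_X, inftyIncl_X]
    rw [h2, h3]
    generalize (LaurentPolynomial.T (-1) : LaurentPolynomial K) ^ (g + 1) = t at *
    generalize (LaurentPolynomial.T 1 : LaurentPolynomial K) ^ (g + 1) = s at *
    linear_combination (-(LaurentPolynomial.C a ^ (4 * h + 3) * (t * s + 1)) -
      (LaurentPolynomial.C b * LaurentPolynomial.C c ^ 2 * LaurentPolynomial.C d) *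
        (LaurentPolynomial.C a ^ (2 * h + 1) * LaurentPolynomial.C b ^ (2 * h + 1)) *
        ((LaurentPolynomial.C a ^ (2 * h + 1) * LaurentPolynomial.C b ^ (2 * h + 1)) *
          (1 + t * s) - 2 * t)) * h1
  cB := by
    have h1 := T_neg_mul (K := K) (g + 1)
    have h2 : (LaurentPolynomial.T (-1) : LaurentPolynomial K) ^ (2 * g + 2) =
        (LaurentPolynomial.T (-1) ^ (g + 1)) ^ 2 := by ring
    have h3 : (LaurentPolynomial.T 1 : LaurentPolynomial K) ^ (2 * g + 2) =
        (LaurentPolynomial.T 1 ^ (g + 1)) ^ 2 := by ring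
    simp only [inftyCoeffs, overlapCoeffs, zeroCoeffs, polyD₀, polyD₁, map_add, map_mul, map_sub,
      map_pow, map_one, zeroIncl_C, inftyIncl_C, zeroIncl_X, inftyIncl_X]
    rw [h2, h3]
    generalize (LaurentPolynomial.T (-1) : LaurentPolynomial K) ^ (g + 1) = t at *
    generalize (LaurentPolynomial.T 1 : LaurentPolynomial K) ^ (g + 1) = s at *
    linear_combination (-(LaurentPolynomial.C a ^ (4 * h + 3) * (t * s + 1)) -
      (LaurentPolynomial.C b * LaurentPolynomial.C c ^ 2 * LaurentPolynomial.C d +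
        LaurentPolynomial.C 2 * LaurentPolynomial.C c) *
        (LaurentPolynomial.C a ^ (2 * h + 1) * LaurentPolynomial.C b ^ (2 * h + 1)) *
        ((LaurentPolynomial.C a ^ (2 * h + 1) * LaurentPolynomial.C b ^ (2 * h + 1)) *
          (1 + t * s) - 2 * t)) * h1
  cC := by
    have h1 := T_neg_mul (K := K) (g + 1)
    have h2 : (LaurentPolynomial.T (-1) : LaurentPolynomial K) ^ (2 * g + 2) =
        (LaurentPolynomial.T (-1) ^ (g + 1)) ^ 2 := by ring
    simp only [inftyCoeffs, overlapCoeffs, zeroCoeffs, map_mul, map_sub,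
      map_pow, map_one, zeroIncl_C, inftyIncl_C, zeroIncl_X, inftyIncl_X]
    rw [h2]
    generalize (LaurentPolynomial.T (-1) : LaurentPolynomial K) ^ (g + 1) = t at *
    generalize (LaurentPolynomial.T 1 : LaurentPolynomial K) ^ (g + 1) = s at *
    linear_combination (-(LaurentPolynomial.C a ^ (2 * h + 1) *
      (LaurentPolynomial.C a ^ (2 * h + 1) * (1 + t * s) - 2 * t))) * h1

instance isOpenImmersion_zero_compat : IsOpenImmersion (zero_compat h g a b c d).map :=
  (zero_compat h g a b c d).isOpenImmersion_map (isLocalization_zeroIncl K)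

instance isOpenImmersion_infty_compat : IsOpenImmersion (infty_compat h g a b c d).map :=
  (infty_compat h g a b c d).isOpenImmersion_map (isLocalization_inftyIncl K)

/-- The total space `S` of the family, glued from its restrictions to the two affine lines. -/
noncomputable def totalSpace : Scheme.{u} :=
  pushout (zero_compat h g a b c d).map (infty_compat h g a b c d).map

/-- The family of surfaces `τ : S ⟶ ℙ¹`. -/
noncomputable def family : totalSpace h g a b c d ⟶ P1 K :=
  pushout.desc ((zeroCoeffs h g a b c d).toSpec ≫ P1.zeroChart K)
    ((inftyCoeffs h g a b c d).toSpec ≫ P1.inftyChart K) <| by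
      rw [← Category.assoc, ← Category.assoc, SurfaceCoeffs.Compat.map_toSpec,
        SurfaceCoeffs.Compat.map_toSpec, Category.assoc, Category.assoc, P1.condition]

end

/-! ### Regular locus, smooth compactifications, split fibres -/

/-- The regular locus of a scheme, as an open subscheme. For a scheme that is locally of finite type
over a field the set of points with regular local ring is open, so that taking the interior does
not change it. -/
def regularLocus (X : Scheme.{u}) : X.Opens :=
  ⟨interior {x | IsRegularLocalRing (X.presheaf.stalk x)}, isOpen_interior⟩

/-- `ρ : Y ⟶ ℙ¹` together with `j : V ⟶ Y` is a smooth compactification over `K` of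
`σ : V ⟶ ℙ¹`: `Y` is smooth and proper over `K`, `j` is an open immersion with dense image, and
`ρ` extends `σ`. -/
structure IsSmoothCompactification {K : Type u} [Field K] {V Y : Scheme.{u}} (σ : V ⟶ P1 K)
    (j : V ⟶ Y) (ρ : Y ⟶ P1 K) : Prop where
  isOpenImmersion : IsOpenImmersion j
  isDominant : IsDominant j
  fac : j ≫ ρ = σ
  smooth : Smooth (ρ ≫ P1.toSpec K)
  isProper : IsProper (ρ ≫ P1.toSpec K)

/-- A scheme over a field (given by its structure morphism) is split if it has an open subscheme
that is geometrically integral over the field; such a subscheme is not empty. -/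
def IsSplit {X : Scheme.{u}} {k : CommRingCat.{u}} (f : X ⟶ Spec k) : Prop :=
  ∃ U : X.Opens, GeometricallyIntegral (U.ι ≫ f)

/-! ### Arithmetic parameters -/

section
open NumberField IsDedekindDomain

/-- `x` lies in `F^{*2}`. -/
def IsNonzeroSquare {F : Type*} [Field F] (x : F) : Prop := x ≠ 0 ∧ IsSquare x

variable {K : Type u} [Field K] [NumberField K]

/-- `x` lies in `K_π^{*2}` for the finite place `π = v`. -/
def IsSquareAt (v : HeightOneSpectrum (𝓞 K)) (x : 𝓞 K) : Prop :=
  IsNonzeroSquare (algebraMap K (v.adicCompletion K) x)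

/-- `x` lies in `K_π^{*2}` for the archimedean place `π = w`. -/
def IsSquareAtInfinite (w : InfinitePlace K) (x : 𝓞 K) : Prop :=
  IsNonzeroSquare (algebraMap K w.Completion x)

/-- The finite place given by the prime ideal that a prime element `p` generates. -/
def principalPlace (p : 𝓞 K) (hp : Prime p) : HeightOneSpectrum (𝓞 K) where
  asIdeal := Ideal.span {p}
  isPrime := (Ideal.span_singleton_prime hp.ne_zero).2 hp
  ne_bot := by simpa using hp.ne_zero

/-- The conditions on the parameters `a, b, c, d`, relative to a finite set `Ω₀` of odd finite
places. -/
structure IsArithmeticParameters (Ω₀ : Finset (HeightOneSpectrum (𝓞 K))) (a b c d : 𝓞 K) :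
    Prop where
  prime_a : Prime a
  prime_b : Prime b
  prime_c : Prime c
  prime_d : Prime d
  distinct : [a, b, c, d].Pairwise fun p q => Ideal.span {p} ≠ Ideal.span {q}
  notMem : ∀ p ∈ [a, b, c, d], ∀ v ∈ Ω₀, v.asIdeal ≠ Ideal.span {p}
  odd : ∀ p ∈ [a, b, c, d], (2 : 𝓞 K) ∉ Ideal.span {p}
  square_Ω₀ : ∀ v ∈ Ω₀, IsSquareAt v a ∧ IsSquareAt v b
  square_infinite : ∀ w : InfinitePlace K, IsSquareAtInfinite w a ∧ IsSquareAtInfinite w b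
  square_even : ∀ v : HeightOneSpectrum (𝓞 K), 2 ∈ v.asIdeal → IsSquareAt v a ∧ IsSquareAt v b
  two_neg_one_at_a :
    IsSquareAt (principalPlace a prime_a) 2 ∧ IsSquareAt (principalPlace a prime_a) (-1)
  two_neg_one_at_b :
    IsSquareAt (principalPlace b prime_b) 2 ∧ IsSquareAt (principalPlace b prime_b) (-1)
  a_mod_b : b ∣ a - 1
  bccd_mod_a : a ∣ b * c ^ 2 * d - 1
  c_at_a : ¬ IsSquareAt (principalPlace a prime_a) c
  c_at_b : ¬ IsSquareAt (principalPlace b prime_b) c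
  d_at_b : ¬ IsSquareAt (principalPlace b prime_b) d
  d_at_c : IsSquareAt (principalPlace c prime_c) d
  a_at_b : IsSquareAt (principalPlace b prime_b) a
  a_at_c : ¬ IsSquareAt (principalPlace c prime_c) a
  b_at_a : IsSquareAt (principalPlace a prime_a) b
  b_at_c : ¬ IsSquareAt (principalPlace c prime_c) b
  d_at_a : IsSquareAt (principalPlace a prime_a) d
  not_dvd : ¬ a ∣ b * c * d + 2

end

end DP4Family

/-!
The regular locus of `S` is open in the compactification. So it suffices to find, for each `θ ∈ ℙ¹`,
an open subscheme of the regular locus whose fibre over `θ` has a geometrically integral open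
subscheme.

Over each of the two affine lines `Spec R`, `R = K[θ]`, consider the chart `v y z ≠ 0` of the
surface (`ChartRing`). With `v = 1` its equations read
`a z² = x² + b (u - A) (u - B)` and `a y² = x² + a C² u`,
so it arises from the affine plane with coordinates `x, u` over `R` by adjoining two invertible
square roots, and is étale over this plane because `2` and `a` are units. Since étale algebras over
regular rings are regular (`isRegularRing_of_etale`), the chart lies in the regular locus.

The fibre of the chart over `θ`, with residue field `κ`, is treated in two cases.
* If `C(θ) ≠ 0`, then the second equation determines `u = (a y² - x²) / (a C²)`, and the fibre is an
  open part of the double plane `a z² = x² + b (u - A) (u - B)` over the `(x, y)`-plane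
  (`exists_cover_of_ne`).
* If `C(θ) = 0`, then `a ^ (2h+1) θ ^ (g+1) = 1` (or `a ^ (2h+1) = θ ^ (g+1)` over the affine line
  that contains infinity). As `g + 1` is even, `a = α²` is a square in `κ`
  (`isSquare_of_zeroCoeffs`, `isSquare_of_inftyCoeffs`), the second equation factors as
  `(x - α y) (x + α y) = 0`, and the part where `x + α y ≠ 0` is an open part of the double plane
  `a z² = x² + b (u - A) (u - B)` over the `(x, u)`-plane (`exists_cover_of_eq`).

A double plane `z² = F` is geometrically integral if `F` is not a square over any extension of `κ`
(`PlaneCover.geometricallyIntegral`). Here `F` is quadratic in `u`, respectively biquadratic in `y`,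
and its discriminant is a polynomial in `x` whose coefficient at `x²` is not zero, so that `F` is
never a square (`not_isSquare_coverPoly_X`, `not_isSquare_coverPoly_uPoly`).
-/

namespace DP4Family

/-! ### Regularity of étale algebras -/

/-- An étale algebra over a regular ring is regular: at a prime `P` over `p` the maximal ideal is
generated by that of the base because the algebra is unramified, and the dimension does not drop
because the algebra is flat. -/
theorem isRegularRing_of_etale (N S : Type*) [CommRing N] [CommRing S] [Algebra N S]
    [IsRegularRing N] [Algebra.Etale N S] : IsRegularRing S := by
  have : IsNoetherianRing S := Algebra.FiniteType.isNoetherianRing N S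
  refine isRegularRing_iff.2 fun P _ => .of_spanFinrank_maximalIdeal_le _ ?_
  let p := P.under N
  let := Localization.AtPrime.algebraOfLiesOver p P
  have hmap := ((Algebra.isUnramifiedAt_iff_map_eq N p P).1 inferInstance).2
  have hreg := (isRegularLocalRing_iff (Localization.AtPrime p)).1 inferInstance
  have hspan : (IsLocalRing.maximalIdeal (Localization.AtPrime P)).spanFinrank ≤
      (IsLocalRing.maximalIdeal (Localization.AtPrime p)).spanFinrank := by
    rw [← hmap, IsScalarTower.algebraMap_eq N (Localization.AtPrime p) (Localization.AtPrime P),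
      ← Ideal.map_map, Localization.AtPrime.map_eq_maximalIdeal]
    exact Ideal.spanFinrank_map_le_of_fg _ (IsLocalRing.maximalIdeal _).fg_of_isNoetherianRing
  have hheight := Ideal.height_eq_height_add_of_liesOver_of_hasGoingDown p P
  rw [IsLocalization.AtPrime.ringKrullDim_eq_height P]
  rw [IsLocalization.AtPrime.ringKrullDim_eq_height p] at hreg
  calc _ ≤ (((IsLocalRing.maximalIdeal (Localization.AtPrime p)).spanFinrank : ℕ) :
        WithBot ℕ∞) := by exact_mod_cast hspan
    _ = p.height := hreg
    _ ≤ P.height := by rw [hheight]; exact_mod_cast le_self_add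

section
open Polynomial

theorem isUnit_two_map {A B : Type*} [CommRing A] [CommRing B] (f : A →+* B)
    (h : IsUnit (2 : A)) : IsUnit (2 : B) := by
  rw [← map_ofNat f 2]
  exact h.map f

/-! ### Étale double covers -/

section
variable {N : Type*} [CommRing N]

/-- The standard étale pair of `z² = F` away from `s z = 0`. -/
noncomputable def sqrtPair (h2 : IsUnit (2 : N)) (F s : N) : StandardEtalePair N where
  f := X ^ 2 - C F
  monic_f := monic_X_pow_sub_C F two_ne_zero
  g := C s * X
  cond := by
    obtain ⟨r, hr⟩ := h2.exists_right_inv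
    refine ⟨C (r * s), 0, 1, ?_⟩
    have hr' : (2 : N[X]) * C r = 1 := by rw [← C_ofNat, ← map_mul, hr, map_one]
    simp only [derivative_sub, derivative_X_pow, derivative_C, map_mul, C_ofNat, Nat.cast_ofNat]
    linear_combination C s * X * hr'

theorem hasMap_sqrtPair_iff (h2 : IsUnit (2 : N)) (F s : N) {S : Type*} [CommRing S] [Algebra N S]
    (z : S) : (sqrtPair h2 F s).HasMap z ↔
      z ^ 2 = algebraMap N S F ∧ IsUnit (algebraMap N S s * z) := by
  rw [StandardEtalePair.HasMap, sqrtPair, map_sub, map_mul, map_pow, aeval_X, aeval_C, aeval_C,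
    sub_eq_zero]

/-- The ring `N[z, (s z)⁻¹] / (z² - F)`, which is étale over `N`. -/
abbrev SqrtRing (h2 : IsUnit (2 : N)) (F s : N) : Type _ := (sqrtPair h2 F s).Ring

namespace SqrtRing

variable (h2 : IsUnit (2 : N)) (F s : N)

/-- The square root of `F` in `SqrtRing h2 F s`. -/
noncomputable def root : SqrtRing h2 F s := StandardEtalePair.X _

theorem root_sq : root h2 F s ^ 2 = algebraMap N _ F :=
  ((hasMap_sqrtPair_iff h2 F s _).1 (sqrtPair h2 F s).hasMap_X).1

theorem isUnit : IsUnit (algebraMap N _ s * root h2 F s) :=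
  ((hasMap_sqrtPair_iff h2 F s _).1 (sqrtPair h2 F s).hasMap_X).2

variable {F s} {S : Type*} [CommRing S]

theorem exists_lift (f : N →+* S) (z : S) (hz : z ^ 2 = f F) (hs : IsUnit (f s * z)) :
    ∃ φ : SqrtRing h2 F s →+* S, φ.comp (algebraMap N _) = f ∧ φ (root h2 F s) = z := by
  let := f.toAlgebra
  have hm := (hasMap_sqrtPair_iff h2 F s z).2 ⟨hz, hs⟩
  exact ⟨((sqrtPair h2 F s).lift z hm).toRingHom,
    AlgHom.comp_algebraMap ((sqrtPair h2 F s).lift z hm), StandardEtalePair.lift_X _ _ _⟩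

theorem hom_ext {φ ψ : SqrtRing h2 F s →+* S}
    (h : φ.comp (algebraMap N _) = ψ.comp (algebraMap N _))
    (hr : φ (root h2 F s) = ψ (root h2 F s)) : φ = ψ := by
  let := (φ.comp (algebraMap N (SqrtRing h2 F s))).toAlgebra
  let φ' : SqrtRing h2 F s →ₐ[N] S := { φ with commutes' := fun r => rfl }
  let ψ' : SqrtRing h2 F s →ₐ[N] S :=
    { ψ with commutes' := fun r => (RingHom.congr_fun h r).symm }
  have : φ' = ψ' := StandardEtalePair.hom_ext hr
  ext x
  exact DFunLike.congr_fun this x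

end SqrtRing

end

/-! ### The chart `v = 1`, `y z ≠ 0` -/

variable {R : Type u} [CommRing R]

/-- The elements `x, y, z, u` satisfy the equations of the surface in the chart `v = 1`, with
coefficients read through `f`, and `y`, `z` are invertible. -/
structure IsChartPoint (P : SurfaceCoeffs R) {S : Type*} [CommRing S] (f : R →+* S)
    (x y z u : S) : Prop where
  eq₁ : x ^ 2 - f P.a * z ^ 2 + f P.b * (u - f P.cA) * (u - f P.cB) = 0
  eq₂ : x ^ 2 - f P.a * y ^ 2 + f (P.a * P.cC ^ 2) * u = 0
  isUnit_y : IsUnit y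
  isUnit_z : IsUnit z

theorem IsChartPoint.map {P : SurfaceCoeffs R} {S S' : Type*} [CommRing S] [CommRing S']
    {f : R →+* S} {x y z u : S} (h : IsChartPoint P f x y z u) (ψ : S →+* S') :
    IsChartPoint P (ψ.comp f) (ψ x) (ψ y) (ψ z) (ψ u) where
  eq₁ := by simpa using congrArg ψ h.eq₁
  eq₂ := by simpa using congrArg ψ h.eq₂
  isUnit_y := h.isUnit_y.map ψ
  isUnit_z := h.isUnit_z.map ψ

/-- The value of `y²` in the chart, as a polynomial in `u` over `R[x]`. It is meant for invertible
`P.a`, where `Ring.inverse` is the inverse. -/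
noncomputable def ySq (P : SurfaceCoeffs R) : R[X][X] :=
  C (C (Ring.inverse P.a)) * (C X ^ 2 + C (C (P.a * P.cC ^ 2)) * X)

/-- The value of `z²` in the chart, as a polynomial in `u` over `R[x]`. It is meant for invertible
`P.a`, where `Ring.inverse` is the inverse. -/
noncomputable def zSq (P : SurfaceCoeffs R) : R[X][X] :=
  C (C (Ring.inverse P.a)) * (C X ^ 2 + C (C P.b) * (X - C (C P.cA)) * (X - C (C P.cB)))

variable (h2 : IsUnit (2 : R)) (P : SurfaceCoeffs R)

/-- The first step of the construction of `ChartRing`: `y` is adjoined to `R[x, u]`. -/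
abbrev ChartRingAux : Type u := SqrtRing (isUnit_two_map (C.comp C : R →+* R[X][X]) h2) (ySq P) 1

/-- The coordinate ring of the open subscheme `v y z ≠ 0` of the surface: both `y` and `z` are
square roots over the polynomial ring in `x` and `u`. -/
abbrev ChartRing : Type u :=
  SqrtRing (isUnit_two_map ((algebraMap R[X][X] (ChartRingAux h2 P)).comp (C.comp C)) h2)
    (algebraMap R[X][X] (ChartRingAux h2 P) (zSq P)) 1

namespace ChartRing

/-- The homomorphism `R[x, u] → ChartRing h2 P`. -/
noncomputable def ofPoly : R[X][X] →+* ChartRing h2 P :=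
  (algebraMap (ChartRingAux h2 P) (ChartRing h2 P)).comp (algebraMap R[X][X] (ChartRingAux h2 P))

/-- The structure homomorphism `R → ChartRing h2 P`. -/
noncomputable def ι : R →+* ChartRing h2 P := (ofPoly h2 P).comp (C.comp C)

/-- The affine coordinate `x / v`. -/
noncomputable def x : ChartRing h2 P := ofPoly h2 P (C X)

/-- The affine coordinate `u / v`. -/
noncomputable def u : ChartRing h2 P := ofPoly h2 P X

/-- The affine coordinate `y / v`. -/
noncomputable def y : ChartRing h2 P := algebraMap (ChartRingAux h2 P) _ (SqrtRing.root _ _ _)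

/-- The affine coordinate `z / v`. -/
noncomputable def z : ChartRing h2 P := SqrtRing.root _ _ _

theorem sq_eq_map_ySq_iff {P : SurfaceCoeffs R} (ha : IsUnit P.a) {S : Type*} [CommRing S]
    (f : R[X][X] →+* S) (y : S) : y ^ 2 = f (ySq P) ↔
      f (C X) ^ 2 - f (C (C P.a)) * y ^ 2 + f (C (C (P.a * P.cC ^ 2))) * f X = 0 := by
  have h1 : f (C (C (Ring.inverse P.a))) * f (C (C P.a)) = 1 := by
    rw [← map_mul, ← map_mul, ← map_mul, Ring.inverse_mul_cancel _ ha]; simp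
  simp only [ySq, map_mul, map_add, map_pow] at h1 ⊢
  constructor
  · intro h; rw [h]
    linear_combination (-f (C X) ^ 2 - f (C (C P.a)) * f (C (C P.cC)) ^ 2 * f X) * h1
  · intro h
    linear_combination (-f (C (C (Ring.inverse P.a)))) * h - y ^ 2 * h1

theorem sq_eq_map_zSq_iff {P : SurfaceCoeffs R} (ha : IsUnit P.a) {S : Type*} [CommRing S]
    (f : R[X][X] →+* S) (z : S) : z ^ 2 = f (zSq P) ↔
      f (C X) ^ 2 - f (C (C P.a)) * z ^ 2 +
        f (C (C P.b)) * (f X - f (C (C P.cA))) * (f X - f (C (C P.cB))) = 0 := by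
  have h1 : f (C (C (Ring.inverse P.a))) * f (C (C P.a)) = 1 := by
    rw [← map_mul, ← map_mul, ← map_mul, Ring.inverse_mul_cancel _ ha]; simp
  simp only [zSq, map_mul, map_add, map_sub, map_pow] at h1 ⊢
  constructor
  · intro h; rw [h]
    linear_combination (-f (C X) ^ 2 -
      f (C (C P.b)) * (f X - f (C (C P.cA))) * (f X - f (C (C P.cB)))) * h1
  · intro h
    linear_combination (-f (C (C (Ring.inverse P.a)))) * h - z ^ 2 * h1

/-- The tautological point of the chart. -/
theorem isChartPoint (ha : IsUnit P.a) :
    IsChartPoint P (ι h2 P) (x h2 P) (y h2 P) (z h2 P) (u h2 P) where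
  eq₁ := (sq_eq_map_zSq_iff ha (ofPoly h2 P) (z h2 P)).1 (SqrtRing.root_sq _ _ _)
  eq₂ := (sq_eq_map_ySq_iff ha (ofPoly h2 P) (y h2 P)).1 <| by
    rw [y, ← map_pow, SqrtRing.root_sq]; rfl
  isUnit_y := by
    have := SqrtRing.isUnit (isUnit_two_map (C.comp C : R →+* R[X][X]) h2) (ySq P) 1
    rw [map_one, one_mul] at this
    exact this.map _
  isUnit_z := by
    have := SqrtRing.isUnit (isUnit_two_map ((algebraMap R[X][X] (ChartRingAux h2 P)).comp
      (C.comp C)) h2) (algebraMap R[X][X] (ChartRingAux h2 P) (zSq P)) 1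
    rwa [map_one, one_mul] at this

variable {h2 P}

theorem exists_lift (ha : IsUnit P.a) {S : Type*} [CommRing S] {f : R →+* S} {x₀ y₀ z₀ u₀ : S}
    (h : IsChartPoint P f x₀ y₀ z₀ u₀) :
    ∃ φ : ChartRing h2 P →+* S, φ.comp (ι h2 P) = f ∧ φ (x h2 P) = x₀ ∧ φ (y h2 P) = y₀ ∧
      φ (z h2 P) = z₀ ∧ φ (u h2 P) = u₀ := by
  obtain ⟨p, hp⟩ : ∃ p : R[X][X] →+* S, p = eval₂RingHom (eval₂RingHom f x₀) u₀ := ⟨_, rfl⟩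
  have hpC : ∀ r, p (C (C r)) = f r := by simp [hp]
  have hpx : p (C X) = x₀ := by simp [hp]
  have hpu : p X = u₀ := by simp [hp]
  obtain ⟨φ₁, h1, h1'⟩ := SqrtRing.exists_lift (isUnit_two_map (C.comp C : R →+* R[X][X]) h2)
    (F := ySq P) (s := 1) p y₀
    ((sq_eq_map_ySq_iff ha p y₀).2 (by rw [hpC, hpC, hpx, hpu]; exact h.eq₂))
    (by rw [map_one, one_mul]; exact h.isUnit_y)
  obtain ⟨φ₂, h2', h2''⟩ := SqrtRing.exists_lift (isUnit_two_map
    ((algebraMap R[X][X] (ChartRingAux h2 P)).comp (C.comp C)) h2)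
    (F := algebraMap R[X][X] (ChartRingAux h2 P) (zSq P)) (s := 1) φ₁ z₀
    (by
      rw [← RingHom.comp_apply, h1]
      exact (sq_eq_map_zSq_iff ha p z₀).2 (by rw [hpC, hpC, hpC, hpC, hpx, hpu]; exact h.eq₁))
    (by rw [map_one, one_mul]; exact h.isUnit_z)
  have hof : φ₂.comp (ofPoly h2 P) = p := by
    rw [ofPoly, ← RingHom.comp_assoc, h2', h1]
  refine ⟨φ₂, ?_, ?_, ?_, h2'', ?_⟩
  · rw [ι, ← RingHom.comp_assoc, hof]
    exact RingHom.ext hpC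
  · exact (RingHom.congr_fun hof _).trans hpx
  · exact (RingHom.congr_fun h2' _).trans h1'
  · exact (RingHom.congr_fun hof _).trans hpu

theorem hom_ext {S : Type*} [CommRing S] {φ ψ : ChartRing h2 P →+* S}
    (h : φ.comp (ι h2 P) = ψ.comp (ι h2 P)) (hx : φ (x h2 P) = ψ (x h2 P))
    (hy : φ (y h2 P) = ψ (y h2 P)) (hz : φ (z h2 P) = ψ (z h2 P))
    (hu : φ (u h2 P) = ψ (u h2 P)) : φ = ψ := by
  refine SqrtRing.hom_ext _ (SqrtRing.hom_ext _ ?_ hy) hz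
  refine Polynomial.ringHom_ext' (Polynomial.ringHom_ext' ?_ hx) hu
  exact h

variable (h2 P)

/-- The chart is étale over the affine plane over the base. -/
theorem isRegularRing [IsRegularRing R] : IsRegularRing (ChartRing h2 P) := by
  have := isRegularRing_of_etale R[X][X] (ChartRingAux h2 P)
  exact isRegularRing_of_etale (ChartRingAux h2 P) (ChartRing h2 P)

end ChartRing

end

section
open CategoryTheory Limits AlgebraicGeometry

/-! ### The chart as an open subscheme of the surface -/

section
open MvPolynomial HomogeneousLocalization

attribute [local instance] MvPolynomial.gradedAlgebra

variable {R : Type u} [CommRing R]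

/-- A homogeneous polynomial of degree `n` at the point `s • w` is `s ^ n` times its value at
`w`. -/
theorem eval₂_mul_of_isHomogeneous {σ S : Type*} [CommRing S] {p : MvPolynomial σ R} {n : ℕ}
    (hp : p.IsHomogeneous n) (f : R →+* S) (w : σ → S) (s : S) :
    eval₂ f (fun i => w i * s) p = eval₂ f w p * s ^ n := by
  rw [eval₂_eq, eval₂_eq, Finset.sum_mul]
  refine Finset.sum_congr rfl fun m hm => ?_
  have hmn : ∑ i ∈ m.support, m i = n := by
    rw [← hp (mem_support_iff.1 hm), Finsupp.weight_apply, Finsupp.sum]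
    simp
  rw [Finset.prod_congr rfl fun i _ => mul_pow _ _ _, Finset.prod_mul_distrib,
    Finset.prod_pow_eq_pow_sum, hmn, mul_assoc]

namespace SurfaceCoeffs

variable (P : SurfaceCoeffs R)

/-- The class of the `i`-th variable in the homogeneous coordinate ring; the variables are
`x, y, z, u, v` in this order. -/
noncomputable def coord (i : Fin 5) : MvPolynomial (Fin 5) R ⧸ P.ideal :=
  Ideal.Quotient.mk P.ideal (X i)

theorem coord_mem (i : Fin 5) : P.coord i ∈ coordGrading P.ideal 1 :=
  mk_mem_quotientGrading _ (isHomogeneous_X R i)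

/-- The element `v y z` of the homogeneous coordinate ring. -/
noncomputable def chartElt : MvPolynomial (Fin 5) R ⧸ P.ideal :=
  P.coord 4 * P.coord 1 * P.coord 2

theorem coord_mul_mem (i j k : Fin 5) :
    P.coord i * P.coord j * P.coord k ∈ coordGrading P.ideal 3 :=
  SetLike.mul_mem_graded (SetLike.mul_mem_graded (P.coord_mem i) (P.coord_mem j)) (P.coord_mem k)

theorem chartElt_mem : P.chartElt ∈ coordGrading P.ideal 3 := P.coord_mul_mem 4 1 2

/-- The ring of the affine open subscheme `v y z ≠ 0` of the surface. -/
abbrev ChartAway : Type u := Away (coordGrading P.ideal) P.chartElt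

/-- The fraction `X_i X_j X_k / (v y z)`. -/
noncomputable def frac (i j k : Fin 5) : P.ChartAway :=
  Away.mk _ P.chartElt_mem 1 (P.coord i * P.coord j * P.coord k)
    (by rw [one_smul]; exact P.coord_mul_mem i j k)

/-- The structure homomorphism of `ChartAway`. -/
noncomputable def awayIncl : R →+* P.ChartAway :=
  (fromZeroRingHom (coordGrading P.ideal) _).comp (algebraMap R (coordGrading P.ideal 0))

/-- The inclusion of `ChartAway` into the full localisation at `v y z`. -/
noncomputable def valHom : P.ChartAway →+* Localization.Away P.chartElt :=
  algebraMap _ _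

theorem valHom_injective : Function.Injective P.valHom := val_injective _

/-- The localisation homomorphism of the homogeneous coordinate ring. -/
noncomputable def locHom : MvPolynomial (Fin 5) R ⧸ P.ideal →+* Localization.Away P.chartElt :=
  algebraMap _ _

/-- The inverse of `v y z` in the localisation. -/
noncomputable def chartInv : Localization.Away P.chartElt := IsLocalization.Away.invSelf P.chartElt

theorem locHom_mul_chartInv :
    P.locHom (P.coord 4) * P.locHom (P.coord 1) * P.locHom (P.coord 2) * P.chartInv = 1 := by
  rw [← map_mul, ← map_mul]
  exact IsLocalization.Away.mul_invSelf P.chartElt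

theorem valHom_mk (n : ℕ) (p : MvPolynomial (Fin 5) R ⧸ P.ideal)
    (hp : p ∈ coordGrading P.ideal (n • 3)) :
    P.valHom (Away.mk _ P.chartElt_mem n p hp) = P.locHom p * P.chartInv ^ n := by
  have h1 : P.locHom P.chartElt * P.chartInv = 1 := IsLocalization.Away.mul_invSelf P.chartElt
  have h2 : P.valHom (Away.mk _ P.chartElt_mem n p hp) * P.locHom P.chartElt ^ n = P.locHom p := by
    rw [← map_pow]
    change (Away.mk _ P.chartElt_mem n p hp).val * _ = _
    rw [Away.val_mk, Localization.mk_eq_mk']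
    exact IsLocalization.mk'_spec _ p (⟨P.chartElt ^ n, n, rfl⟩ : Submonoid.powers P.chartElt)
  rw [← h2, mul_assoc, ← mul_pow, h1, one_pow, mul_one]

theorem valHom_frac (i j k : Fin 5) : P.valHom (P.frac i j k) =
    P.locHom (P.coord i) * P.locHom (P.coord j) * P.locHom (P.coord k) * P.chartInv := by
  rw [frac, valHom_mk, map_mul, map_mul, pow_one]

theorem valHom_awayIncl (r : R) :
    P.valHom (P.awayIncl r) = P.locHom (Ideal.Quotient.mk _ (C r)) := by
  change Localization.mk _ _ = _
  exact Localization.mk_one_eq_algebraMap _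

/-- The affine coordinates `X_i / v` satisfy the equations of the chart. -/
theorem isChartPoint_frac :
    IsChartPoint P P.awayIncl (P.frac 0 1 2) (P.frac 1 1 2) (P.frac 2 1 2) (P.frac 3 1 2) := by
  have h := P.locHom_mul_chartInv
  have h1 : P.locHom (Ideal.Quotient.mk _ P.quadric₁) = 0 := by
    rw [Ideal.Quotient.eq_zero_iff_mem.2
      (show P.quadric₁ ∈ P.ideal from Ideal.subset_span (Or.inl rfl)), map_zero]
  have h2 : P.locHom (Ideal.Quotient.mk _ P.quadric₂) = 0 := by
    rw [Ideal.Quotient.eq_zero_iff_mem.2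
      (show P.quadric₂ ∈ P.ideal from Ideal.subset_span (Or.inr rfl)), map_zero]
  -- `s = y z / (v y z)` is the inverse of `v`.
  obtain ⟨s, hs⟩ : ∃ s, s = P.locHom (P.coord 1) * P.locHom (P.coord 2) * P.chartInv := ⟨_, rfl⟩
  have h4 : P.locHom (P.coord 4) * s = 1 := by rw [hs, ← h]; ring
  have hf : ∀ i, P.valHom (P.frac i 1 2) = P.locHom (P.coord i) * s := by
    intro i; rw [valHom_frac, hs]; ring
  refine ⟨?_, ?_, ?_, ?_⟩
  · refine P.valHom_injective ?_
    simp only [quadric₁, map_add, map_sub, map_mul, map_pow, ← P.valHom_awayIncl] at h1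
    simp only [map_add, map_sub, map_mul, map_pow, hf, map_zero]
    simp only [coord] at h4 ⊢
    linear_combination s ^ 2 * h1 + P.valHom (P.awayIncl P.b) *
      ((P.valHom (P.awayIncl P.cA) + P.valHom (P.awayIncl P.cB)) *
        P.locHom (Ideal.Quotient.mk _ (X 3)) * s -
      P.valHom (P.awayIncl P.cA) * P.valHom (P.awayIncl P.cB) *
        (P.locHom (Ideal.Quotient.mk _ (X 4)) * s + 1)) * h4
  · refine P.valHom_injective ?_
    simp only [quadric₂, map_add, map_sub, map_mul, map_pow, ← P.valHom_awayIncl] at h2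
    simp only [map_add, map_sub, map_mul, map_pow, hf, map_zero]
    simp only [coord] at h4 ⊢
    linear_combination s ^ 2 * h2 - P.valHom (P.awayIncl P.a) * P.valHom (P.awayIncl P.cC) ^ 2 *
      P.locHom (Ideal.Quotient.mk _ (X 3)) * s * h4
  -- The inverse of `y / v` is `v / y = v² z / (v y z)`, and similarly for `z`.
  · refine IsUnit.of_mul_eq_one (P.frac 4 4 2) (P.valHom_injective ?_)
    rw [map_mul, map_one, hf, valHom_frac]
    linear_combination h + P.locHom (P.coord 1) * P.locHom (P.coord 4) *
      P.locHom (P.coord 2) * P.chartInv * h4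
  · refine IsUnit.of_mul_eq_one (P.frac 4 4 1) (P.valHom_injective ?_)
    rw [map_mul, map_one, hf, valHom_frac]
    linear_combination h + P.locHom (P.coord 1) * P.locHom (P.coord 4) *
      P.locHom (P.coord 2) * P.chartInv * h4

variable (h2 : IsUnit (2 : R)) {P}

section
variable (ha : IsUnit P.a)

/-- Setting `v = 1` in the homogeneous coordinate ring. -/
noncomputable def dehom : MvPolynomial (Fin 5) R ⧸ P.ideal →+* ChartRing h2 P :=
  Ideal.Quotient.lift P.ideal (eval₂Hom (ChartRing.ι h2 P)
    ![ChartRing.x h2 P, ChartRing.y h2 P, ChartRing.z h2 P, ChartRing.u h2 P, 1]) <| by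
      have h := ChartRing.isChartPoint h2 P ha
      intro p hp
      rw [← RingHom.mem_ker]
      refine Ideal.span_le.2 ?_ hp
      rintro _ (rfl | rfl)
      · rw [SetLike.mem_coe, RingHom.mem_ker, ← h.eq₁]
        simp [quadric₁]
      · rw [SetLike.mem_coe, RingHom.mem_ker, ← h.eq₂]
        simp [quadric₂]

theorem dehom_mk (p : MvPolynomial (Fin 5) R) : dehom h2 ha (Ideal.Quotient.mk _ p) =
    eval₂ (ChartRing.ι h2 P)
      ![ChartRing.x h2 P, ChartRing.y h2 P, ChartRing.z h2 P, ChartRing.u h2 P, 1] p := rfl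

theorem dehom_coord (i : Fin 5) : dehom h2 ha (P.coord i) =
    ![ChartRing.x h2 P, ChartRing.y h2 P, ChartRing.z h2 P, ChartRing.u h2 P, 1] i := by
  rw [coord, dehom_mk, eval₂_X]

theorem isUnit_dehom_chartElt : IsUnit (dehom h2 ha P.chartElt) := by
  have h := ChartRing.isChartPoint h2 P ha
  rw [chartElt, map_mul, map_mul, dehom_coord, dehom_coord, dehom_coord]
  simpa using And.intro h.isUnit_y h.isUnit_z

/-- The homomorphism from the ring of the open subscheme `v y z ≠ 0` to `ChartRing`. -/
noncomputable def awayToChart : P.ChartAway →+* ChartRing h2 P :=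
  (IsLocalization.Away.lift P.chartElt (isUnit_dehom_chartElt h2 ha)).comp P.valHom

theorem lift_locHom (p : MvPolynomial (Fin 5) R ⧸ P.ideal) :
    IsLocalization.Away.lift P.chartElt (isUnit_dehom_chartElt h2 ha) (P.locHom p) =
      dehom h2 ha p :=
  IsLocalization.Away.lift_eq _ _ _

theorem awayToChart_awayIncl (r : R) :
    awayToChart h2 ha (P.awayIncl r) = ChartRing.ι h2 P r := by
  rw [awayToChart, RingHom.comp_apply, valHom_awayIncl, lift_locHom, dehom_mk, eval₂_C]

theorem awayToChart_frac (i : Fin 5) : awayToChart h2 ha (P.frac i 1 2) =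
    ![ChartRing.x h2 P, ChartRing.y h2 P, ChartRing.z h2 P, ChartRing.u h2 P, 1] i := by
  have h := congrArg (IsLocalization.Away.lift P.chartElt (isUnit_dehom_chartElt h2 ha))
    P.locHom_mul_chartInv
  rw [map_mul, map_mul, map_mul, lift_locHom, lift_locHom, lift_locHom, map_one] at h
  rw [awayToChart, RingHom.comp_apply, valHom_frac, map_mul, map_mul, map_mul, lift_locHom,
    lift_locHom, lift_locHom, ← dehom_coord h2 ha i]
  have h4 : dehom h2 ha (P.coord 4) = 1 := dehom_coord h2 ha 4
  rw [h4, one_mul] at h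
  rw [mul_assoc, mul_assoc, ← mul_assoc (dehom h2 ha (P.coord 1)), h, mul_one]

/-- The inverse of `awayToChart`. It is surjective because a fraction `p / (v y z) ^ n` with `p`
homogeneous of degree `3 n` equals `p(x, y, z, u, 1) / (y z) ^ n` in the affine coordinates. -/
theorem exists_chartToAway : ∃ ψ : ChartRing h2 P →+* P.ChartAway,
    ψ.comp (ChartRing.ι h2 P) = P.awayIncl ∧ Function.Surjective ψ ∧
      (awayToChart h2 ha).comp ψ = .id _ := by
  obtain ⟨ψ, hι, hx, hy, hz, hu⟩ := ChartRing.exists_lift (h2 := h2) ha P.isChartPoint_frac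
  refine ⟨ψ, hι, ?_, ?_⟩
  · have h := P.locHom_mul_chartInv
    obtain ⟨s, hs⟩ : ∃ s, s = P.locHom (P.coord 1) * P.locHom (P.coord 2) * P.chartInv := ⟨_, rfl⟩
    have h4 : P.locHom (P.coord 4) * s = 1 := by rw [hs, ← h]; ring
    have hf : ∀ i, P.valHom (P.frac i 1 2) = P.locHom (P.coord i) * s := by
      intro i; rw [valHom_frac, hs]; ring
    have hpt := ChartRing.isChartPoint h2 P ha
    obtain ⟨r, hr⟩ := (hpt.isUnit_y.mul hpt.isUnit_z).exists_right_inv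
    intro b
    obtain ⟨n, q, hq, rfl⟩ := Away.mk_surjective _ P.chartElt_mem b
    obtain ⟨p, hp, hpq⟩ : ∃ p : MvPolynomial (Fin 5) R, p.IsHomogeneous (n • 3) ∧
      Ideal.Quotient.mk P.ideal p = q := id hq
    refine ⟨dehom h2 ha (Ideal.Quotient.mk _ p) * r ^ n, P.valHom_injective ?_⟩
    have hψ : P.valHom (ψ (dehom h2 ha (Ideal.Quotient.mk _ p))) =
        P.locHom (Ideal.Quotient.mk _ p) * s ^ (n • 3) := by
      have e1 : P.valHom (ψ (dehom h2 ha (Ideal.Quotient.mk _ p))) =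
          eval₂ (P.valHom.comp P.awayIncl) (fun i => P.locHom (P.coord i) * s) p := by
        rw [dehom_mk, ← RingHom.comp_apply, hom_eval₂, RingHom.comp_assoc, hι]
        congr 1
        funext i
        fin_cases i
        · exact (congrArg P.valHom hx).trans (hf 0)
        · exact (congrArg P.valHom hy).trans (hf 1)
        · exact (congrArg P.valHom hz).trans (hf 2)
        · exact (congrArg P.valHom hu).trans (hf 3)
        · exact ((congrArg _ (map_one ψ)).trans (map_one P.valHom)).trans h4.symm
      have e2 : P.locHom (Ideal.Quotient.mk _ p) =
          eval₂ (P.valHom.comp P.awayIncl) (fun i => P.locHom (P.coord i)) p := by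
        have h3 : P.valHom.comp P.awayIncl =
            (P.locHom.comp (Ideal.Quotient.mk P.ideal)).comp C :=
          RingHom.ext P.valHom_awayIncl
        rw [h3]
        conv_lhs => rw [← eval₂_eta p]
        exact hom_eval₂ p C (P.locHom.comp (Ideal.Quotient.mk P.ideal)) X
      rw [e1, e2, eval₂_mul_of_isHomogeneous hp]
    have hv : P.locHom (P.coord 1) * s * (P.locHom (P.coord 2) * s) * P.valHom (ψ r) = 1 := by
      have := congrArg (P.valHom.comp ψ) hr
      rw [map_one, map_mul, map_mul, RingHom.comp_apply, RingHom.comp_apply, RingHom.comp_apply,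
        hy, hz, hf, hf] at this
      exact this
    have hinv : P.chartInv = s ^ 3 * P.valHom (ψ r) := by
      linear_combination (-P.chartInv) * hv - s ^ 2 * P.valHom (ψ r) * hs
    rw [valHom_mk, map_mul, map_mul, hψ, map_pow, map_pow, hinv, hpq, smul_eq_mul, mul_comm n 3,
      mul_pow, pow_mul]
    ring
  · refine ChartRing.hom_ext ?_ ?_ ?_ ?_ ?_
    · rw [RingHom.comp_assoc, hι]
      exact RingHom.ext (awayToChart_awayIncl h2 ha)
    · rw [RingHom.comp_apply, hx]; exact awayToChart_frac h2 ha 0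
    · rw [RingHom.comp_apply, hy]; exact awayToChart_frac h2 ha 1
    · rw [RingHom.comp_apply, hz]; exact awayToChart_frac h2 ha 2
    · rw [RingHom.comp_apply, hu]; exact awayToChart_frac h2 ha 3

end

/-- The spectrum of `ChartRing` is an open subscheme of the surface, over the base. -/
theorem exists_chart_isOpenImmersion (ha : IsUnit P.a) :
    ∃ i : Spec (.of (ChartRing h2 P)) ⟶ P.surface,
    IsOpenImmersion i ∧ i ≫ P.toSpec = Spec.map (CommRingCat.ofHom (ChartRing.ι h2 P)) := by
  obtain ⟨ψ, hι, hs, hid⟩ := exists_chartToAway h2 ha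
  have he : (awayToChart h2 ha).comp P.awayIncl = ChartRing.ι h2 P :=
    RingHom.ext (awayToChart_awayIncl h2 ha)
  have hiso : IsIso (CommRingCat.ofHom (awayToChart h2 ha)) := by
    refine ⟨CommRingCat.ofHom ψ, ?_, ?_⟩
    · refine CommRingCat.hom_ext (RingHom.ext fun b => ?_)
      obtain ⟨c, rfl⟩ := hs b
      exact congrArg ψ (RingHom.congr_fun hid c)
    · rw [← CommRingCat.ofHom_comp, hid]; rfl
  refine ⟨Spec.map (CommRingCat.ofHom (awayToChart h2 ha)) ≫
    Proj.awayι (coordGrading P.ideal) P.chartElt P.chartElt_mem (by norm_num), inferInstance, ?_⟩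
  rw [toSpec, Category.assoc, Proj.awayι_toSpecZero_assoc, ← Spec.map_comp, ← Spec.map_comp,
    ← CommRingCat.ofHom_comp, ← CommRingCat.ofHom_comp, ← he]
  rfl

end SurfaceCoeffs
end

end

section
open CategoryTheory Limits AlgebraicGeometry Polynomial

/-! ### Double planes -/

section
variable {k : Type u} [CommRing k] (h2 : IsUnit (2 : k)) (F s : k[X][X])

/-- The coordinate ring of the open part `s z ≠ 0` of the double plane `z² = F`. -/
abbrev PlaneCover : Type u := SqrtRing (isUnit_two_map (C.comp C : k →+* k[X][X]) h2) F s

namespace PlaneCover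

/-- The structure homomorphism of `PlaneCover`. -/
noncomputable def ι : k →+* PlaneCover h2 F s := (algebraMap k[X][X] _).comp (C.comp C)

/-- The inner variable of `k[X][X]`, as a function on the double plane. -/
noncomputable def fstCoord : PlaneCover h2 F s := algebraMap k[X][X] _ (C X)

/-- The outer variable of `k[X][X]`, as a function on the double plane. -/
noncomputable def sndCoord : PlaneCover h2 F s := algebraMap k[X][X] _ X

/-- The square root of `F`, as a function on the double plane. -/
noncomputable def root : PlaneCover h2 F s := SqrtRing.root _ F s

theorem algebraMap_eq : algebraMap k[X][X] (PlaneCover h2 F s) =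
    eval₂RingHom (eval₂RingHom (ι h2 F s) (fstCoord h2 F s)) (sndCoord h2 F s) := by
  refine Polynomial.ringHom_ext' (Polynomial.ringHom_ext' ?_ ?_) ?_
  · ext r; simp [ι]
  · simp [fstCoord]
  · simp [sndCoord]

theorem root_sq : root h2 F s ^ 2 =
    eval₂ (eval₂RingHom (ι h2 F s) (fstCoord h2 F s)) (sndCoord h2 F s) F := by
  rw [← coe_eval₂RingHom, ← algebraMap_eq]
  exact SqrtRing.root_sq _ F s

theorem isUnit : IsUnit (eval₂ (eval₂RingHom (ι h2 F s) (fstCoord h2 F s)) (sndCoord h2 F s) s *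
    root h2 F s) := by
  rw [← coe_eval₂RingHom, ← algebraMap_eq]
  exact SqrtRing.isUnit _ F s

variable {F s}

theorem exists_lift {S : Type*} [CommRing S] (f : k →+* S) (p q z : S)
    (hz : z ^ 2 = eval₂ (eval₂RingHom f p) q F) (hs : IsUnit (eval₂ (eval₂RingHom f p) q s * z)) :
    ∃ φ : PlaneCover h2 F s →+* S, φ.comp (ι h2 F s) = f ∧ φ (fstCoord h2 F s) = p ∧
      φ (sndCoord h2 F s) = q ∧ φ (root h2 F s) = z := by
  obtain ⟨φ, h, hr⟩ := SqrtRing.exists_lift (isUnit_two_map (C.comp C : k →+* k[X][X]) h2)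
    (eval₂RingHom (eval₂RingHom f p) q) z hz hs
  refine ⟨φ, ?_, ?_, ?_, hr⟩
  · rw [ι, ← RingHom.comp_assoc, h]; ext r; simp
  · exact (RingHom.congr_fun h _).trans (by simp)
  · exact (RingHom.congr_fun h _).trans (by simp)

theorem hom_ext {S : Type*} [CommRing S] {φ ψ : PlaneCover h2 F s →+* S}
    (h : φ.comp (ι h2 F s) = ψ.comp (ι h2 F s)) (hp : φ (fstCoord h2 F s) = ψ (fstCoord h2 F s))
    (hq : φ (sndCoord h2 F s) = ψ (sndCoord h2 F s)) (hr : φ (root h2 F s) = ψ (root h2 F s)) :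
    φ = ψ := by
  refine SqrtRing.hom_ext _ ?_ hr
  refine Polynomial.ringHom_ext' (Polynomial.ringHom_ext' ?_ hp) hq
  exact h

end PlaneCover
end

/-- If `F` is not a square, then the double cover `z² = F` of a factorial scheme is integral. -/
theorem SqrtRing.isDomain {N : Type*} [CommRing N] [IsDomain N] [UniqueFactorizationMonoid N]
    (h2 : IsUnit (2 : N)) {F s : N} (hF : ¬ IsSquare F) (hs : s ≠ 0) :
    IsDomain (SqrtRing h2 F s) := by
  obtain ⟨P, hP⟩ : ∃ P, P = sqrtPair h2 F s := ⟨_, rfl⟩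
  have hf : P.f = X ^ 2 - C F := by rw [hP]; rfl
  have hg : P.g = C s * X := by rw [hP]; rfl
  have hdeg : P.f.natDegree = 2 := by rw [hf, natDegree_X_pow_sub_C]
  have hirr : Irreducible P.f := by
    rw [P.monic_f.irreducible_iff_roots_eq_zero_of_degree_le_three hdeg.ge (by omega),
      Multiset.eq_zero_iff_forall_notMem]
    intro r hr
    have := isRoot_of_mem_roots hr
    rw [hf, IsRoot.def, eval_sub, eval_pow, eval_X, eval_C, sub_eq_zero] at this
    exact hF ⟨r, by rw [← this, sq]⟩
  have := AdjoinRoot.isDomain_of_prime hirr.prime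
  have hne : AdjoinRoot.mk P.f P.g ≠ 0 := by
    refine AdjoinRoot.mk_ne_zero_of_natDegree_lt P.monic_f ?_ ?_
    · rw [hg]; exact mul_ne_zero (C_ne_zero.2 hs) X_ne_zero
    · rw [hdeg, hg, natDegree_C_mul_X _ hs]; norm_num
  have : IsDomain (Localization.Away (AdjoinRoot.mk P.f P.g)) :=
    IsLocalization.isDomain_localization (powers_le_nonZeroDivisors_of_noZeroDivisors hne)
  have h3 : IsDomain P.Ring := P.equivAwayAdjoinRoot.toMulEquiv.isDomain _
  rw [hP] at h3
  exact h3

/-- A commutative square of ring homomorphisms with the universal property of the tensor product is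
a pushout. -/
theorem isPushout_of_exists_of_ext {A B C D : Type u} [CommRing A] [CommRing B] [CommRing C]
    [CommRing D] {f : A →+* B} {g : A →+* C} {i : B →+* D} {j : C →+* D}
    (hw : i.comp f = j.comp g)
    (hex : ∀ (S : Type u) [CommRing S] (p : B →+* S) (q : C →+* S), p.comp f = q.comp g →
      ∃ d : D →+* S, d.comp i = p ∧ d.comp j = q)
    (hext : ∀ (S : Type u) [CommRing S] (d d' : D →+* S), d.comp i = d'.comp i →
      d.comp j = d'.comp j → d = d') :
    IsPushout (CommRingCat.ofHom f) (CommRingCat.ofHom g) (CommRingCat.ofHom i)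
      (CommRingCat.ofHom j) := by
  have hw' : CommRingCat.ofHom f ≫ CommRingCat.ofHom i =
      CommRingCat.ofHom g ≫ CommRingCat.ofHom j := by
    rw [← CommRingCat.ofHom_comp, ← CommRingCat.ofHom_comp, hw]
  have key (t : PushoutCocone (CommRingCat.ofHom f) (CommRingCat.ofHom g)) :
      ∃ d : D →+* t.pt, d.comp i = t.inl.hom ∧ d.comp j = t.inr.hom :=
    hex _ _ _ (congrArg CommRingCat.Hom.hom t.condition)
  refine ⟨⟨hw'⟩,
    ⟨PushoutCocone.IsColimit.mk _ (fun t => CommRingCat.ofHom (key t).choose) ?_ ?_ ?_⟩⟩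
  · exact fun t => CommRingCat.hom_ext (key t).choose_spec.1
  · exact fun t => CommRingCat.hom_ext (key t).choose_spec.2
  · intro t m h1 h2
    refine CommRingCat.hom_ext (hext _ _ _ ?_ ?_)
    · exact (congrArg CommRingCat.Hom.hom h1).trans (key t).choose_spec.1.symm
    · exact (congrArg CommRingCat.Hom.hom h2).trans (key t).choose_spec.2.symm

/-- The double plane `z² = F` is compatible with base change. -/
theorem PlaneCover.exists_isPushout {k l : Type u} [CommRing k] [CommRing l] (h2 : IsUnit (2 : k))
    (F s : k[X][X]) (σ : k →+* l) : ∃ j : PlaneCover h2 F s →+*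
      PlaneCover (isUnit_two_map σ h2) (F.map (mapRingHom σ)) (s.map (mapRingHom σ)),
      IsPushout (CommRingCat.ofHom (ι h2 F s)) (CommRingCat.ofHom σ) (CommRingCat.ofHom j)
        (CommRingCat.ofHom (ι _ _ _)) := by
  have hmap : ∀ {S : Type u} [CommRing S] (f : l →+* S) (p q : S) (G : k[X][X]),
      eval₂ (eval₂RingHom f p) q (G.map (mapRingHom σ)) =
        eval₂ (eval₂RingHom (f.comp σ) p) q G := by
    intro S _ f p q G
    rw [eval₂_map]
    congr 1
    refine Polynomial.ringHom_ext' ?_ ?_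
    · ext r; simp
    · simp
  obtain ⟨j, hj, hp, hq, hr⟩ := exists_lift h2 (F := F) (s := s)
    ((ι (isUnit_two_map σ h2) (F.map (mapRingHom σ)) (s.map (mapRingHom σ))).comp σ)
    (fstCoord _ _ _) (sndCoord _ _ _) (root _ _ _)
    (by rw [← hmap]; exact root_sq _ _ _) (by rw [← hmap]; exact isUnit _ _ _)
  refine ⟨j, isPushout_of_exists_of_ext hj ?_ ?_⟩
  · intro S _ p q hpq
    obtain ⟨d, hd, hdp, hdq, hdr⟩ := exists_lift (isUnit_two_map σ h2)
      (F := F.map (mapRingHom σ)) (s := s.map (mapRingHom σ)) q (p (fstCoord _ _ _))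
      (p (sndCoord _ _ _)) (p (root _ _ _))
      (by
        rw [hmap, ← hpq, ← map_pow, root_sq, hom_eval₂]
        congr 1
        refine Polynomial.ringHom_ext' ?_ ?_
        · ext r; simp
        · simp)
      (by
        rw [hmap, ← hpq]
        have := (isUnit h2 F s).map p
        rw [map_mul, hom_eval₂] at this
        convert! this using 3
        refine Polynomial.ringHom_ext' ?_ ?_
        · ext r; simp
        · simp)
    refine ⟨d, hom_ext _ ?_ ?_ ?_ ?_, hd⟩
    · rw [RingHom.comp_assoc, hj, ← RingHom.comp_assoc, hd, hpq]
    · rw [RingHom.comp_apply, hp, hdp]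
    · rw [RingHom.comp_apply, hq, hdq]
    · rw [RingHom.comp_apply, hr, hdr]
  · intro S _ d d' h1 h3
    refine hom_ext _ h3 ?_ ?_ ?_
    · have := RingHom.congr_fun h1 (fstCoord h2 F s)
      rwa [RingHom.comp_apply, RingHom.comp_apply, hp] at this
    · have := RingHom.congr_fun h1 (sndCoord h2 F s)
      rwa [RingHom.comp_apply, RingHom.comp_apply, hq] at this
    · have := RingHom.congr_fun h1 (root h2 F s)
      rwa [RingHom.comp_apply, RingHom.comp_apply, hr] at this

/-- The double plane `z² = F` is geometrically integral if `F` does not become a square over any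
extension field. -/
theorem PlaneCover.geometricallyIntegral {k : Type u} [Field k] (h2 : IsUnit (2 : k))
    {F s : k[X][X]} (hs : s ≠ 0)
    (hF : ∀ (l : Type u) [Field l] (σ : k →+* l), ¬ IsSquare (F.map (mapRingHom σ))) :
    GeometricallyIntegral (Spec.map (CommRingCat.ofHom (ι h2 F s))) := by
  refine ⟨fun l _ y Z fst snd h => ?_⟩
  obtain ⟨σ, rfl⟩ := Spec.map_surjective y
  obtain ⟨j, hj⟩ := exists_isPushout h2 F s σ.hom
  have hpb := isPullback_SpecMap_of_isPushout _ _ _ _ hj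
  have hs' : s.map (mapRingHom σ.hom) ≠ 0 :=
    (Polynomial.map_ne_zero_iff (map_injective _ σ.hom.injective)).2 hs
  have := SqrtRing.isDomain (isUnit_two_map (C.comp C : l →+* l[X][X])
    (isUnit_two_map σ.hom h2)) (hF l σ.hom) hs'
  exact .of_isIso (h.isoIsPullback _ _ hpb).inv

end

section
open CategoryTheory Limits AlgebraicGeometry Polynomial

/-! ### The double planes that occur in the fibres -/

section
variable {D : Type*} [CommRing D] [IsDomain D]

theorem natDegree_le_of_sq_natDegree_le {n : ℕ} {p : D[X]} (hp : (p * p).natDegree ≤ 2 * n) :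
    p.natDegree ≤ n := by
  rw [← sq, natDegree_pow] at hp
  omega

/-- A quadratic polynomial that is a square has discriminant zero. -/
theorem discrim_eq_zero_of_isSquare {α β γ : D}
    (h : IsSquare (C α * X ^ 2 + C β * X + C γ)) : β ^ 2 = 4 * α * γ := by
  obtain ⟨p, hp⟩ := h
  have hd : p.natDegree ≤ 1 :=
    natDegree_le_of_sq_natDegree_le (by rw [← hp]; compute_degree)
  rw [eq_X_add_C_of_natDegree_le_one hd] at hp
  generalize p.coeff 0 = c₀ at hp
  generalize p.coeff 1 = c₁ at hp
  have e : (C c₁ * X + C c₀) * (C c₁ * X + C c₀) =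
      C (c₁ * c₁) * X ^ 2 + C (2 * c₀ * c₁) * X + C (c₀ * c₀) := by
    simp only [map_mul, C_ofNat]; ring
  rw [e] at hp
  have h0 := congrArg (coeff · 0) hp
  have h1 := congrArg (coeff · 1) hp
  have h2 := congrArg (coeff · 2) hp
  simp only [coeff_add, coeff_C_mul, coeff_X_pow, coeff_X, coeff_C] at h0 h1 h2
  norm_num at h0 h1 h2
  rw [h0, h1, h2]; ring

/-- A biquadratic polynomial that is a square is the square of a polynomial in `X ^ 2`, so its
discriminant as a polynomial in `X ^ 2` vanishes. -/
theorem discrim_eq_zero_of_isSquare_biquadratic (h2 : (2 : D) ≠ 0) {α β γ : D} (hα : α ≠ 0)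
    (h : IsSquare (C α * X ^ 4 + C β * X ^ 2 + C γ)) : β ^ 2 = 4 * α * γ := by
  obtain ⟨p, hp⟩ := h
  have hd : p.natDegree ≤ 2 :=
    natDegree_le_of_sq_natDegree_le (by rw [← hp]; compute_degree)
  rw [p.as_sum_range_C_mul_X_pow' (show p.natDegree < 3 by omega)] at hp
  simp only [Finset.sum_range_succ, Finset.sum_range_zero] at hp
  generalize p.coeff 0 = c₀ at hp
  generalize p.coeff 1 = c₁ at hp
  generalize p.coeff 2 = c₂ at hp
  have e : (0 + C c₀ * X ^ 0 + C c₁ * X ^ 1 + C c₂ * X ^ 2) *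
      (0 + C c₀ * X ^ 0 + C c₁ * X ^ 1 + C c₂ * X ^ 2) = C (c₂ * c₂) * X ^ 4 +
        C (2 * c₁ * c₂) * X ^ 3 + C (c₁ * c₁ + 2 * c₀ * c₂) * X ^ 2 + C (2 * c₀ * c₁) * X +
        C (c₀ * c₀) := by
    simp only [map_mul, map_add, C_ofNat]; ring
  rw [e] at hp
  have h0 := congrArg (coeff · 0) hp
  have h2' := congrArg (coeff · 2) hp
  have h3 := congrArg (coeff · 3) hp
  have h4 := congrArg (coeff · 4) hp
  simp only [coeff_add, coeff_C_mul, coeff_X_pow, coeff_X, coeff_C] at h0 h2' h3 h4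
  norm_num at h0 h2' h3 h4
  have hc₂ : c₂ ≠ 0 := by rintro rfl; simp [h4] at hα
  have hc₁ : c₁ = 0 := by
    rcases h3 with (h | h) | h
    · exact absurd h h2
    · exact h
    · exact absurd h hc₂
  rw [h0, h2', h4, hc₁]; ring

end

section
variable {k : Type u} [CommRing k]

/-- The polynomial `r (x² + b (U - A) (U - B))`, where `x` is the inner variable. -/
noncomputable def coverPoly (r b A B : k) (U : k[X][X]) : k[X][X] :=
  C (C r) * (C X ^ 2 + C (C b) * (U - C (C A)) * (U - C (C B)))

/-- The polynomial `q (a y² - x²)`, where `x` is the inner and `y` is the outer variable. -/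
noncomputable def uPoly (q a : k) : k[X][X] := C (C q) * (C (C a) * X ^ 2 - C X ^ 2)

theorem map_coverPoly {l : Type u} [CommRing l] (σ : k →+* l) (r b A B : k) (U : k[X][X]) :
    (coverPoly r b A B U).map (mapRingHom σ) =
      coverPoly (σ r) (σ b) (σ A) (σ B) (U.map (mapRingHom σ)) := by
  simp [coverPoly]

theorem map_uPoly {l : Type u} [CommRing l] (σ : k →+* l) (q a : k) :
    (uPoly q a).map (mapRingHom σ) = uPoly (σ q) (σ a) := by
  simp [uPoly]

end

section
variable {k : Type u} [Field k] {r b A B q a : k}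

/-- The discriminants of the two polynomials below have a nonzero coefficient at `x²`. -/
theorem discrim_ne_zero (h2 : (2 : k) ≠ 0) (hr : r ≠ 0) (hb : b ≠ 0) {g : k} (hg : g ≠ 0) :
    C (r ^ 2 * b ^ 2 * g ^ 2 * (A - B) ^ 2) - C (4 * r ^ 2 * b * g ^ 2) * X ^ 2 ≠ (0 : k[X]) := by
  intro h
  have := congrArg (coeff · 2) h
  simp only [coeff_sub, coeff_C_mul, coeff_X_pow, coeff_C] at this
  have h4 : (4 : k) ≠ 0 := by simpa [show (4 : k) = 2 * 2 by norm_num] using h2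
  norm_num [hr, hb, hg, h4] at this

theorem not_isSquare_coverPoly_X (h2 : (2 : k) ≠ 0) (hr : r ≠ 0) (hb : b ≠ 0) :
    ¬ IsSquare (coverPoly r b A B X) := by
  have e : coverPoly r b A B X = C (C (r * b)) * X ^ 2 + C (C (-(r * b * (A + B)))) * X +
      C (C r * X ^ 2 + C (r * b * A * B)) := by
    simp only [coverPoly, map_mul, map_add, map_neg, map_pow]; ring
  rw [e]
  intro h
  have := discrim_eq_zero_of_isSquare h
  refine discrim_ne_zero (A := A) (B := B) h2 hr hb one_ne_zero ?_
  simp only [map_mul, map_add, map_neg, map_pow, map_sub, C_ofNat, map_one] at this ⊢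
  linear_combination this

theorem not_isSquare_coverPoly_uPoly (h2 : (2 : k) ≠ 0) (hr : r ≠ 0) (hb : b ≠ 0) (hq : q ≠ 0)
    (ha : a ≠ 0) : ¬ IsSquare (coverPoly r b A B (uPoly q a)) := by
  have e : coverPoly r b A B (uPoly q a) = C (C (r * b * (q * a) ^ 2)) * X ^ 4 +
      C (C (-(r * b * (q * a))) * (C (2 * q) * X ^ 2 + C (A + B))) * X ^ 2 +
      C (C r * X ^ 2 + C (r * b) * (C q * X ^ 2 + C A) * (C q * X ^ 2 + C B)) := by
    simp only [coverPoly, uPoly, map_mul, map_add, map_neg, map_pow, C_ofNat]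
    ring
  rw [e]
  intro h
  have := discrim_eq_zero_of_isSquare_biquadratic (by rw [← C_ofNat]; exact C_ne_zero.2 h2)
    (C_ne_zero.2 (by simp [hr, hb, hq, ha])) h
  refine discrim_ne_zero (A := A) (B := B) h2 hr hb (mul_ne_zero hq ha) ?_
  simp only [map_mul, map_add, map_neg, map_pow, map_sub, C_ofNat] at this ⊢
  linear_combination this

end

/-! ### Open subschemes of the fibres -/

/-- A homomorphism that is a localisation at `t`, by the universal property, induces an open
immersion. -/
theorem isOpenImmersion_SpecMap_of_away {A B : Type u} [CommRing A] [CommRing B] (δ : A →+* B)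
    (t : A) (ht : IsUnit (δ t)) (ψ : B →+* Localization.Away t)
    (h1 : ψ.comp δ = algebraMap A (Localization.Away t))
    (h3 : (IsLocalization.Away.lift t ht).comp ψ = .id B) :
    IsOpenImmersion (Spec.map (CommRingCat.ofHom δ)) := by
  have h4 : ψ.comp (IsLocalization.Away.lift t ht) = .id (Localization.Away t) := by
    refine IsLocalization.ringHom_ext (Submonoid.powers t) ?_
    rw [RingHom.comp_assoc, IsLocalization.Away.lift_comp, h1]
    rfl
  have : IsIso (CommRingCat.ofHom (IsLocalization.Away.lift (S := Localization.Away t) t ht)) :=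
    ⟨CommRingCat.ofHom ψ, by rw [← CommRingCat.ofHom_comp, h4]; rfl,
      by rw [← CommRingCat.ofHom_comp, h3]; rfl⟩
  have he : δ = (IsLocalization.Away.lift t ht).comp (algebraMap A (Localization.Away t)) :=
    (IsLocalization.Away.lift_comp t ht).symm
  have : IsOpenImmersion (Spec.map (CommRingCat.ofHom (algebraMap A (Localization.Away t)))) :=
    IsOpenImmersion.of_isLocalization t
  rw [he, CommRingCat.ofHom_comp, Spec.map_comp]
  infer_instance

end

/-! ### Fibres of the chart -/

section
open CategoryTheory Limits AlgebraicGeometry Polynomial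

section
variable {S : Type*} [CommRing S]

theorem eval₂_coverPoly {k : Type u} [CommRing k] (f : k →+* S) (p w : S) (r b A B : k)
    (U : k[X][X]) :
    eval₂ (eval₂RingHom f p) w (coverPoly r b A B U) =
      f r * (p ^ 2 + f b * (eval₂ (eval₂RingHom f p) w U - f A) *
        (eval₂ (eval₂RingHom f p) w U - f B)) := by
  simp [coverPoly, eval₂_mul, eval₂_add, eval₂_sub, eval₂_pow]

theorem eval₂_uPoly {k : Type u} [CommRing k] (f : k →+* S) (p w : S) (q a : k) :
    eval₂ (eval₂RingHom f p) w (uPoly q a) = f q * (f a * w ^ 2 - p ^ 2) := by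
  simp [uPoly, eval₂_mul, eval₂_sub, eval₂_pow]

end

section
variable {A B C D : Type u} [CommRing A] [CommRing B] [CommRing C] [CommRing D]
  {f : A →+* B} {g : A →+* C} {i : B →+* D} {j : C →+* D}
  {S : Type u} [CommRing S]

theorem comp_eq_of_isPushout (h : IsPushout (CommRingCat.ofHom f) (CommRingCat.ofHom g)
    (CommRingCat.ofHom i) (CommRingCat.ofHom j)) :
    i.comp f = j.comp g := congrArg CommRingCat.Hom.hom h.w

theorem exists_desc_of_isPushout (h : IsPushout (CommRingCat.ofHom f) (CommRingCat.ofHom g)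
    (CommRingCat.ofHom i) (CommRingCat.ofHom j))
    {p : B →+* S} {q : C →+* S} (hpq : p.comp f = q.comp g) :
    ∃ d : D →+* S, d.comp i = p ∧ d.comp j = q := by
  have hw : CommRingCat.ofHom f ≫ CommRingCat.ofHom p =
      CommRingCat.ofHom g ≫ CommRingCat.ofHom q := by
    rw [← CommRingCat.ofHom_comp, ← CommRingCat.ofHom_comp, hpq]
  exact ⟨(h.desc _ _ hw).hom, congrArg CommRingCat.Hom.hom (h.inl_desc _ _ hw),
    congrArg CommRingCat.Hom.hom (h.inr_desc _ _ hw)⟩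

theorem hom_ext_of_isPushout (h : IsPushout (CommRingCat.ofHom f) (CommRingCat.ofHom g)
    (CommRingCat.ofHom i) (CommRingCat.ofHom j))
    {d d' : D →+* S} (hi : d.comp i = d'.comp i)
    (hj : d.comp j = d'.comp j) : d = d' := by
  have : CommRingCat.ofHom d = CommRingCat.ofHom d' :=
    h.hom_ext (CommRingCat.hom_ext hi) (CommRingCat.hom_ext hj)
  exact congrArg CommRingCat.Hom.hom this

end

section
variable {R κ A : Type u} [CommRing R] [Field κ] [CommRing A] {h2 : IsUnit (2 : R)}
  {P : SurfaceCoeffs R} {φ : R →+* κ} {i : ChartRing h2 P →+* A} {j : κ →+* A}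

/-- If `C` does not vanish at the point, then the second equation determines `u`, and the fibre of
the chart is the open part `y z ≠ 0` of a double cover of the `(x, y)`-plane. -/
theorem exists_cover_of_ne (ha : IsUnit P.a)
    (hA : IsPushout (CommRingCat.ofHom (ChartRing.ι h2 P)) (CommRingCat.ofHom φ)
      (CommRingCat.ofHom i) (CommRingCat.ofHom j)) (hC : φ P.cC ≠ 0) :
    ∃ δ : A →+* PlaneCover (isUnit_two_map φ h2) (coverPoly (φ P.a)⁻¹ (φ P.b) (φ P.cA) (φ P.cB)
      (uPoly (φ (P.a * P.cC ^ 2))⁻¹ (φ P.a))) X,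
      δ.comp j = PlaneCover.ι _ _ _ ∧ IsOpenImmersion (Spec.map (CommRingCat.ofHom δ)) := by
  have ha0 : φ P.a ≠ 0 := (ha.map φ).ne_zero
  have he0 : φ (P.a * P.cC ^ 2) ≠ 0 := by
    rw [map_mul, map_pow]; exact mul_ne_zero ha0 (pow_ne_zero _ hC)
  obtain ⟨F, hF⟩ : ∃ F, F = coverPoly (φ P.a)⁻¹ (φ P.b) (φ P.cA) (φ P.cB)
    (uPoly (φ (P.a * P.cC ^ 2))⁻¹ (φ P.a)) := ⟨_, rfl⟩
  rw [← hF]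
  obtain ⟨ι, hι⟩ : ∃ ι, ι = PlaneCover.ι (isUnit_two_map φ h2) F X := ⟨_, rfl⟩
  obtain ⟨x, hx⟩ : ∃ x, x = PlaneCover.fstCoord (isUnit_two_map φ h2) F X := ⟨_, rfl⟩
  obtain ⟨y, hy⟩ : ∃ y, y = PlaneCover.sndCoord (isUnit_two_map φ h2) F X := ⟨_, rfl⟩
  obtain ⟨z, hz⟩ : ∃ z, z = PlaneCover.root (isUnit_two_map φ h2) F X := ⟨_, rfl⟩
  have inv_a : ∀ {S : Type u} [CommRing S] (f : κ →+* S), f (φ P.a)⁻¹ * f (φ P.a) = 1 := by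
    intro S _ f; rw [← map_mul, inv_mul_cancel₀ ha0, map_one]
  have inv_e : ∀ {S : Type u} [CommRing S] (f : κ →+* S),
      f (φ (P.a * P.cC ^ 2))⁻¹ * f (φ (P.a * P.cC ^ 2)) = 1 := by
    intro S _ f; rw [← map_mul, inv_mul_cancel₀ he0, map_one]
  have hroot := PlaneCover.root_sq (isUnit_two_map φ h2) F X
  have hunit := PlaneCover.isUnit (isUnit_two_map φ h2) F X
  rw [← hι, ← hx, ← hy, ← hz] at hroot hunit
  have hFe : ∀ {S : Type u} [CommRing S] (f : κ →+* S) (p w : S),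
      eval₂ (eval₂RingHom f p) w F = f (φ P.a)⁻¹ * (p ^ 2 + f (φ P.b) *
        (f (φ (P.a * P.cC ^ 2))⁻¹ * (f (φ P.a) * w ^ 2 - p ^ 2) - f (φ P.cA)) *
        (f (φ (P.a * P.cC ^ 2))⁻¹ * (f (φ P.a) * w ^ 2 - p ^ 2) - f (φ P.cB))) := by
    intro S _ f p w; rw [hF, eval₂_coverPoly, eval₂_uPoly]
  rw [hFe] at hroot
  rw [eval₂_X] at hunit
  have hpt : IsChartPoint P (ι.comp φ) x y z
      (ι (φ (P.a * P.cC ^ 2))⁻¹ * (ι (φ P.a) * y ^ 2 - x ^ 2)) := by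
    refine ⟨?_, ?_, isUnit_of_mul_isUnit_left hunit, isUnit_of_mul_isUnit_right hunit⟩
    · simp only [RingHom.comp_apply]
      linear_combination (-ι (φ P.a)) * hroot - (x ^ 2 + ι (φ P.b) *
        (ι (φ (P.a * P.cC ^ 2))⁻¹ * (ι (φ P.a) * y ^ 2 - x ^ 2) - ι (φ P.cA)) *
        (ι (φ (P.a * P.cC ^ 2))⁻¹ * (ι (φ P.a) * y ^ 2 - x ^ 2) - ι (φ P.cB))) * inv_a ι
    · simp only [RingHom.comp_apply]
      linear_combination (ι (φ P.a) * y ^ 2 - x ^ 2) * inv_e ι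
  obtain ⟨δ₀, hδι, hδx, hδy, hδz, hδu⟩ := ChartRing.exists_lift (h2 := h2) ha hpt
  obtain ⟨δ, hδi, hδj⟩ := exists_desc_of_isPushout hA hδι
  refine ⟨δ, hδj.trans hι, ?_⟩
  have hδi' : ∀ b, δ (i b) = δ₀ b := RingHom.congr_fun hδi
  -- Here `δ` is an isomorphism, that is, a localisation at `1`.
  obtain ⟨g, hg⟩ : ∃ g, g = algebraMap A (Localization.Away (1 : A)) := ⟨_, rfl⟩
  have hT := ((ChartRing.isChartPoint h2 P ha).map i).map g
  rw [comp_eq_of_isPushout hA] at hT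
  have hu : g (i (ChartRing.u h2 P)) = g (j (φ (P.a * P.cC ^ 2))⁻¹) *
      (g (j (φ P.a)) * g (i (ChartRing.y h2 P)) ^ 2 - g (i (ChartRing.x h2 P)) ^ 2) := by
    have h1 := hT.eq₂
    have h3 := inv_e (g.comp j)
    simp only [RingHom.comp_apply] at h1 h3
    linear_combination g (j (φ (P.a * P.cC ^ 2))⁻¹) * h1 - g (i (ChartRing.u h2 P)) * h3
  obtain ⟨ψ, hψι, hψx, hψy, hψz⟩ := PlaneCover.exists_lift (isUnit_two_map φ h2) (F := F)
    (s := X) (g.comp j) (g (i (ChartRing.x h2 P))) (g (i (ChartRing.y h2 P)))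
    (g (i (ChartRing.z h2 P)))
    (by
      have h1 := hT.eq₁
      have h3 := inv_a (g.comp j)
      rw [hFe]
      simp only [RingHom.comp_apply] at h1 h3 ⊢
      rw [← hu]
      linear_combination (-g (j (φ P.a)⁻¹)) * h1 - g (i (ChartRing.z h2 P)) ^ 2 * h3)
    (by rw [eval₂_X]; exact hT.isUnit_y.mul hT.isUnit_z)
  rw [← hι] at hψι
  rw [← hx] at hψx
  rw [← hy] at hψy
  rw [← hz] at hψz
  have h1 : IsUnit (δ 1) := by rw [map_one]; exact isUnit_one
  refine isOpenImmersion_SpecMap_of_away δ 1 h1 ψ ?_ ?_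
  · rw [← hg]
    refine hom_ext_of_isPushout hA ?_ ?_
    · refine ChartRing.hom_ext ?_ ?_ ?_ ?_ ?_
      · rw [show (ψ.comp δ).comp i = ψ.comp δ₀ by rw [RingHom.comp_assoc, hδi],
          RingHom.comp_assoc, hδι, ← RingHom.comp_assoc, hψι, RingHom.comp_assoc,
          RingHom.comp_assoc, comp_eq_of_isPushout hA]
      · simp only [RingHom.comp_apply, hδi', hδx, hψx]
      · simp only [RingHom.comp_apply, hδi', hδy, hψy]
      · simp only [RingHom.comp_apply, hδi', hδz, hψz]
      · simp only [RingHom.comp_apply, hδi', hδu, map_mul, map_sub, map_pow, hψx, hψy, hu,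
          ← RingHom.comp_apply ψ ι, hψι]
    · rw [RingHom.comp_assoc, hδj, hψι]
  · have hl : ∀ b, IsLocalization.Away.lift (1 : A) h1 (g b) = δ b := fun b => by
      rw [hg]; exact IsLocalization.Away.lift_eq _ _ _
    refine PlaneCover.hom_ext _ ?_ ?_ ?_ ?_
    · rw [← hι, RingHom.comp_assoc, hψι, ← RingHom.comp_assoc]
      refine (RingHom.ext fun r => ?_ : _ = ι)
      simp only [RingHom.comp_apply, hl]
      exact RingHom.congr_fun hδj r
    · rw [← hx]
      simp only [RingHom.comp_apply, RingHom.id_apply, hψx, hl, hδi', hδx]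
    · rw [← hy]
      simp only [RingHom.comp_apply, RingHom.id_apply, hψy, hl, hδi', hδy]
    · rw [← hz]
      simp only [RingHom.comp_apply, RingHom.id_apply, hψz, hl, hδi', hδz]

/-- If `C` vanishes at the point and `a = α²` there, then the second equation becomes
`x² = (α y)²`; the part of the fibre of the chart where `x + α y ≠ 0` is the open part `x z ≠ 0`
of a double cover of the `(x, u)`-plane. -/
theorem exists_cover_of_eq (ha : IsUnit P.a)
    (hA : IsPushout (CommRingCat.ofHom (ChartRing.ι h2 P)) (CommRingCat.ofHom φ)
      (CommRingCat.ofHom i) (CommRingCat.ofHom j)) (hC : φ P.cC = 0) {α : κ}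
    (hα : φ P.a = α * α) :
    ∃ δ : A →+* PlaneCover (isUnit_two_map φ h2)
      (coverPoly (φ P.a)⁻¹ (φ P.b) (φ P.cA) (φ P.cB) X) (Polynomial.C X),
      δ.comp j = PlaneCover.ι _ _ _ ∧ IsOpenImmersion (Spec.map (CommRingCat.ofHom δ)) := by
  have ha0 : φ P.a ≠ 0 := (ha.map φ).ne_zero
  have hα0 : α ≠ 0 := by rintro rfl; exact ha0 (by rw [hα, mul_zero])
  obtain ⟨F, hF⟩ : ∃ F, F = coverPoly (φ P.a)⁻¹ (φ P.b) (φ P.cA) (φ P.cB) X := ⟨_, rfl⟩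
  rw [← hF]
  obtain ⟨ι, hι⟩ : ∃ ι, ι = PlaneCover.ι (isUnit_two_map φ h2) F (Polynomial.C X) := ⟨_, rfl⟩
  obtain ⟨x, hx⟩ : ∃ x, x = PlaneCover.fstCoord (isUnit_two_map φ h2) F (Polynomial.C X) :=
    ⟨_, rfl⟩
  obtain ⟨u, hu⟩ : ∃ u, u = PlaneCover.sndCoord (isUnit_two_map φ h2) F (Polynomial.C X) :=
    ⟨_, rfl⟩
  obtain ⟨z, hz⟩ : ∃ z, z = PlaneCover.root (isUnit_two_map φ h2) F (Polynomial.C X) := ⟨_, rfl⟩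
  have inv_a : ∀ {S : Type u} [CommRing S] (f : κ →+* S), f (φ P.a)⁻¹ * f (φ P.a) = 1 := by
    intro S _ f; rw [← map_mul, inv_mul_cancel₀ ha0, map_one]
  have inv_α : ∀ {S : Type u} [CommRing S] (f : κ →+* S), f α⁻¹ * f α = 1 := by
    intro S _ f; rw [← map_mul, inv_mul_cancel₀ hα0, map_one]
  have sq_α : ∀ {S : Type u} [CommRing S] (f : κ →+* S), f (φ P.a) = f α ^ 2 := by
    intro S _ f; rw [hα, map_mul, sq]
  have hroot := PlaneCover.root_sq (isUnit_two_map φ h2) F (Polynomial.C X)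
  have hunit := PlaneCover.isUnit (isUnit_two_map φ h2) F (Polynomial.C X)
  rw [← hι, ← hx, ← hu, ← hz] at hroot hunit
  have hFe : ∀ {S : Type u} [CommRing S] (f : κ →+* S) (p w : S),
      eval₂ (eval₂RingHom f p) w F = f (φ P.a)⁻¹ * (p ^ 2 + f (φ P.b) *
        (w - f (φ P.cA)) * (w - f (φ P.cB))) := by
    intro S _ f p w; rw [hF, eval₂_coverPoly, eval₂_X]
  rw [hFe] at hroot
  rw [eval₂_C, coe_eval₂RingHom, eval₂_X] at hunit
  have hxu := isUnit_of_mul_isUnit_left hunit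
  have hpt : IsChartPoint P (ι.comp φ) x (x * ι α⁻¹) z u := by
    refine ⟨?_, ?_, hxu.mul (IsUnit.of_mul_eq_one _ (inv_α ι)),
      isUnit_of_mul_isUnit_right hunit⟩
    · simp only [RingHom.comp_apply]
      linear_combination (-ι (φ P.a)) * hroot - (x ^ 2 + ι (φ P.b) *
        (u - ι (φ P.cA)) * (u - ι (φ P.cB))) * inv_a ι
    · simp only [RingHom.comp_apply, map_mul, map_pow, hC, map_zero, sq_α ι]
      linear_combination (-x ^ 2 * (ι α⁻¹ * ι α + 1)) * inv_α ι
  obtain ⟨δ₀, hδι, hδx, hδy, hδz, hδu⟩ := ChartRing.exists_lift (h2 := h2) ha hpt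
  obtain ⟨δ, hδi, hδj⟩ := exists_desc_of_isPushout hA hδι
  refine ⟨δ, hδj.trans hι, ?_⟩
  have hδi' : ∀ b, δ (i b) = δ₀ b := RingHom.congr_fun hδi
  have hδj' : ∀ r, δ (j r) = ι r := RingHom.congr_fun hδj
  obtain ⟨t, ht⟩ : ∃ t, t = i (ChartRing.x h2 P) + j α * i (ChartRing.y h2 P) := ⟨_, rfl⟩
  have h1 : IsUnit (δ t) := by
    have : δ t = 2 * x := by
      rw [ht, map_add, map_mul, hδj', hδi', hδi', hδx, hδy]
      linear_combination x * inv_α ι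
    rw [this]
    exact (isUnit_two_map (ι.comp φ) h2).mul hxu
  -- The homomorphism `δ` is the localisation at `t = x + α y`.
  obtain ⟨g, hg⟩ : ∃ g, g = algebraMap A (Localization.Away t) := ⟨_, rfl⟩
  have hT := ((ChartRing.isChartPoint h2 P ha).map i).map g
  rw [comp_eq_of_isPushout hA] at hT
  -- As `x² = (α y)²` and `x + α y` is invertible, `x = α y`.
  have hxy : g (i (ChartRing.x h2 P)) = g (j α) * g (i (ChartRing.y h2 P)) := by
    have h3 := hT.eq₂
    have htu : IsUnit (g t) := by rw [hg]; exact IsLocalization.Away.algebraMap_isUnit t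
    simp only [RingHom.comp_apply, map_mul, map_pow, hC, map_zero, sq_α j] at h3
    have hgt : g t = g (i (ChartRing.x h2 P)) + g (j α) * g (i (ChartRing.y h2 P)) := by
      rw [← map_mul, ← map_add, ← ht]
    rw [hgt] at htu
    rw [← sub_eq_zero, ← htu.mul_right_eq_zero]
    linear_combination h3
  obtain ⟨ψ, hψι, hψx, hψu, hψz⟩ := PlaneCover.exists_lift (isUnit_two_map φ h2) (F := F)
    (s := Polynomial.C X) (g.comp j) (g (i (ChartRing.x h2 P))) (g (i (ChartRing.u h2 P)))
    (g (i (ChartRing.z h2 P)))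
    (by
      have h3 := hT.eq₁
      have h4 := inv_a (g.comp j)
      rw [hFe]
      simp only [RingHom.comp_apply] at h3 h4 ⊢
      linear_combination (-g (j (φ P.a)⁻¹)) * h3 - g (i (ChartRing.z h2 P)) ^ 2 * h4)
    (by
      rw [eval₂_C, coe_eval₂RingHom, eval₂_X, hxy]
      exact ((IsUnit.of_mul_eq_one _ ((mul_comm _ _).trans (inv_α (g.comp j)))).mul
        hT.isUnit_y).mul hT.isUnit_z)
  rw [← hι] at hψι
  rw [← hx] at hψx
  rw [← hu] at hψu
  rw [← hz] at hψz
  refine isOpenImmersion_SpecMap_of_away δ t h1 ψ ?_ ?_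
  · rw [← hg]
    refine hom_ext_of_isPushout hA ?_ ?_
    · refine ChartRing.hom_ext ?_ ?_ ?_ ?_ ?_
      · rw [show (ψ.comp δ).comp i = ψ.comp δ₀ by rw [RingHom.comp_assoc, hδi],
          RingHom.comp_assoc, hδι, ← RingHom.comp_assoc, hψι, RingHom.comp_assoc,
          RingHom.comp_assoc, comp_eq_of_isPushout hA]
      · simp only [RingHom.comp_apply, hδi', hδx, hψx]
      · have h3 := inv_α (g.comp j)
        have h4 := RingHom.congr_fun hψι α⁻¹
        simp only [RingHom.comp_apply] at h3 h4
        simp only [RingHom.comp_apply, hδi', hδy, map_mul, hψx, h4]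
        rw [hxy]
        linear_combination g (i (ChartRing.y h2 P)) * h3
      · simp only [RingHom.comp_apply, hδi', hδz, hψz]
      · simp only [RingHom.comp_apply, hδi', hδu, hψu]
    · rw [RingHom.comp_assoc, hδj, hψι]
  · have hl : ∀ b, IsLocalization.Away.lift t h1 (g b) = δ b := fun b => by
      rw [hg]; exact IsLocalization.Away.lift_eq _ _ _
    refine PlaneCover.hom_ext _ ?_ ?_ ?_ ?_
    · rw [← hι, RingHom.comp_assoc, hψι, ← RingHom.comp_assoc]
      refine (RingHom.ext fun r => ?_ : _ = ι)
      simp only [RingHom.comp_apply, hl]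
      exact RingHom.congr_fun hδj r
    · rw [← hx]
      simp only [RingHom.comp_apply, RingHom.id_apply, hψx, hl, hδi', hδx]
    · rw [← hu]
      simp only [RingHom.comp_apply, RingHom.id_apply, hψu, hl, hδi', hδu]
    · rw [← hz]
      simp only [RingHom.comp_apply, RingHom.id_apply, hψz, hl, hδi', hδz]

/-- The fibre of the chart at a point with values in a field has a geometrically integral open
subscheme, provided that `a` is a square at the point if `C` vanishes there. -/
theorem exists_geometricallyIntegral (ha : IsUnit P.a)
    (hA : IsPushout (CommRingCat.ofHom (ChartRing.ι h2 P)) (CommRingCat.ofHom φ)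
      (CommRingCat.ofHom i) (CommRingCat.ofHom j)) (hb : φ P.b ≠ 0)
    (hC : φ P.cC = 0 → IsSquare (φ P.a)) :
    ∃ (Z : Scheme.{u}) (e : Z ⟶ Spec (.of A)), IsOpenImmersion e ∧
      GeometricallyIntegral (e ≫ Spec.map (CommRingCat.ofHom j)) := by
  have ha0 : φ P.a ≠ 0 := (ha.map φ).ne_zero
  have h2κ := isUnit_two_map φ h2
  by_cases hC0 : φ P.cC = 0
  · obtain ⟨α, hα⟩ := hC hC0
    obtain ⟨δ, hδ, hopen⟩ := exists_cover_of_eq ha hA hC0 hα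
    refine ⟨_, _, hopen, ?_⟩
    rw [← Spec.map_comp, ← CommRingCat.ofHom_comp, hδ]
    refine PlaneCover.geometricallyIntegral _ (C_ne_zero.2 X_ne_zero) fun l _ σ => ?_
    rw [map_coverPoly, map_X]
    exact not_isSquare_coverPoly_X (isUnit_two_map σ h2κ).ne_zero
      (by simpa using ha0) (by simpa using hb)
  · obtain ⟨δ, hδ, hopen⟩ := exists_cover_of_ne ha hA hC0
    refine ⟨_, _, hopen, ?_⟩
    rw [← Spec.map_comp, ← CommRingCat.ofHom_comp, hδ]
    refine PlaneCover.geometricallyIntegral _ X_ne_zero fun l _ σ => ?_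
    rw [map_coverPoly, map_uPoly]
    exact not_isSquare_coverPoly_uPoly (isUnit_two_map σ h2κ).ne_zero
      (by simpa using ha0) (by simpa using hb) (by simp [ha0, hC0]) (by simpa using ha0)

end

end

section
open CategoryTheory Limits AlgebraicGeometry Polynomial

/-! ### Pushouts of schemes along open immersions -/

section
variable {U X Y : Scheme.{u}} (f : U ⟶ X) (g : U ⟶ Y) [IsOpenImmersion f] [IsOpenImmersion g]

theorem isOpenImmersion_pushout_inl : IsOpenImmersion (pushout.inl f g) :=
  inferInstanceAs (IsOpenImmersion (colimit.ι (span f g) WalkingSpan.left))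

theorem isOpenImmersion_pushout_inr : IsOpenImmersion (pushout.inr f g) :=
  inferInstanceAs (IsOpenImmersion (colimit.ι (span f g) WalkingSpan.right))

theorem mem_range_pushout_inl_or_inr (p : (pushout f g : Scheme.{u})) :
    p ∈ Set.range (pushout.inl f g) ∨ p ∈ Set.range (pushout.inr f g) := by
  obtain ⟨i, q, hq⟩ := Scheme.IsLocallyDirected.ι_jointly_surjective (span f g) p
  obtain _ | _ | _ := i
  · rw [← colimit.w (span f g) WalkingSpan.Hom.fst, Scheme.Hom.comp_apply] at hq
    exact .inl ⟨_, hq⟩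
  · exact .inl ⟨q, hq⟩
  · exact .inr ⟨q, hq⟩

end

/-! ### Split fibres of a compactification -/

/-- The image of the spectrum of a regular ring is open, so it lies in the interior of the set of
regular points. -/
theorem range_subset_regularLocus {T : Type u} [CommRing T] [IsRegularRing T] {X : Scheme.{u}}
    (i : Spec (.of T) ⟶ X) [IsOpenImmersion i] : Set.range i ⊆ regularLocus X := by
  refine interior_maximal ?_ i.isOpenEmbedding.isOpen_range
  rintro _ ⟨p, rfl⟩
  have : p.asIdeal.IsPrime := PrimeSpectrum.isPrime p
  have e₁ : Localization.AtPrime p.asIdeal ≃+* (Spec (.of T)).presheaf.stalk p :=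
    (Spec.stalkIso (.of T) p).symm.commRingCatIsoToRingEquiv
  have e₂ := (asIso (i.stalkMap p)).commRingCatIsoToRingEquiv
  exact IsRegularLocalRing.of_ringEquiv (e₁.trans e₂.symm)

theorem IsSplit.of_isOpenImmersion {Z X : Scheme.{u}} {k : CommRingCat.{u}} (e : Z ⟶ X)
    (f : X ⟶ Spec k) [IsOpenImmersion e] (h : GeometricallyIntegral (e ≫ f)) : IsSplit f := by
  refine ⟨e.opensRange, ?_⟩
  rw [← e.isoOpensRange_inv_comp_assoc]
  rw [GeometricallyIntegral.eq_geometrically] at h ⊢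
  exact (MorphismProperty.cancel_left_of_respectsIso (geometrically IsIntegral) _ _).2 h

/-- Let `Y` contain the regular locus of `S` as an open subscheme, and let the surface with
coefficients `P` be an open subscheme of `S` that lies over an affine open subscheme `Spec R` of the
base. The fibre of the chart over a point of `Spec R` is then open in the fibre of `Y`; it has a
geometrically integral open subscheme, as `b` does not vanish at the point and `a` is a square there
in case `C` vanishes. -/
theorem isSplit_fiber {S B Y : Scheme.{u}} {τ : S ⟶ B} {j : (regularLocus S).toScheme ⟶ Y}
    [IsOpenImmersion j] {ρ : Y ⟶ B} (hfac : j ≫ ρ = (regularLocus S).ι ≫ τ)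
    {R : Type u} [CommRing R] [IsRegularRing R] (h2 : IsUnit (2 : R)) {P : SurfaceCoeffs R}
    (ha : IsUnit P.a) {c : Spec (.of R) ⟶ B} [IsOpenImmersion c] {k : P.surface ⟶ S}
    [IsOpenImmersion k] (hk : k ≫ τ = P.toSpec ≫ c)
    (hP : ∀ {κ : Type u} [Field κ] (φ : R →+* κ),
      φ P.b ≠ 0 ∧ (φ P.cC = 0 → IsSquare (φ P.a)))
    {θ : B} (hθ : θ ∈ Set.range c) : IsSplit (ρ.fiberToSpecResidueField θ) := by
  have := ChartRing.isRegularRing h2 P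
  obtain ⟨i, _, hi⟩ := SurfaceCoeffs.exists_chart_isOpenImmersion h2 ha
  -- The chart lies in the regular locus, so it is an open subscheme of `Y`.
  have hr : Set.range (i ≫ k) ⊆ Set.range (regularLocus S).ι := by
    rw [Scheme.Opens.range_ι]; exact range_subset_regularLocus _
  obtain ⟨q, hq⟩ : ∃ q, q = IsOpenImmersion.lift (regularLocus S).ι (i ≫ k) hr := ⟨_, rfl⟩
  have hqι : q ≫ (regularLocus S).ι = i ≫ k := by rw [hq, IsOpenImmersion.lift_fac]
  have : IsOpenImmersion (q ≫ (regularLocus S).ι) := by rw [hqι]; infer_instance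
  have : IsOpenImmersion q := IsOpenImmersion.of_comp q (regularLocus S).ι
  have hqρ : (q ≫ j) ≫ ρ = Spec.map (CommRingCat.ofHom (ChartRing.ι h2 P)) ≫ c := by
    rw [Category.assoc, hfac, ← Category.assoc, hqι, Category.assoc, hk, ← Category.assoc, hi]
  -- The point `θ`, as a ring homomorphism to its residue field.
  have hθ' : Set.range (B.fromSpecResidueField θ) ⊆ Set.range c := by
    rw [Scheme.range_fromSpecResidueField]; simpa using hθ
  obtain ⟨φ, hφ⟩ := Spec.map_surjective (IsOpenImmersion.lift c (B.fromSpecResidueField θ) hθ')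
  have hφc : Spec.map φ ≫ c = B.fromSpecResidueField θ := by
    rw [hφ, IsOpenImmersion.lift_fac]
  have hA := IsPushout.of_hasPushout (CommRingCat.ofHom (ChartRing.ι h2 P)) φ
  obtain ⟨Z, e, _, he⟩ := exists_geometricallyIntegral (φ := φ.hom)
    (i := (pushout.inl (CommRingCat.ofHom (ChartRing.ι h2 P)) φ).hom)
    (j := (pushout.inr (CommRingCat.ofHom (ChartRing.ι h2 P)) φ).hom) ha hA
    (hP φ.hom).1 (hP φ.hom).2
  -- As `c` is a monomorphism, the fibre product over `Spec R` is also the one over `B`.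
  have hpb := (isPullback_SpecMap_of_isPushout _ _ _ _ hA).paste_vert
    (IsPullback.of_vert_isIso_mono (snd := 𝟙 _) (f := c) ⟨(Category.id_comp _).symm⟩)
  rw [Category.comp_id, ← hqρ, hφc] at hpb
  obtain ⟨m, hm, hmj⟩ : ∃ m, IsPullback _ m (q ≫ j) (ρ.fiberι θ) ∧
      m ≫ ρ.fiberToSpecResidueField θ =
        Spec.map (pushout.inr (CommRingCat.ofHom (ChartRing.ι h2 P)) φ) :=
    have hpb' := IsPullback.of_hasPullback ρ (B.fromSpecResidueField θ)
    ⟨_, IsPullback.of_bot' hpb hpb', hpb'.lift_snd _ _ _⟩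
  have : IsOpenImmersion m := MorphismProperty.of_isPullback hm inferInstance
  refine IsSplit.of_isOpenImmersion (e ≫ m) _ ?_
  rw [Category.assoc, hmj]
  exact he

/-! ### Fibres over the two affine lines -/

section
variable {K : Type u} [Field K] {h g : ℕ} {a b c d : K} {κ : Type*} [Field κ]

/-- If `C' = 0`, then `a ^ (2h+1) θ' ^ (g+1) = 1`; as `g + 1` is even, `a` is a square. -/
theorem isSquare_of_zeroCoeffs (hg : Odd g) (φ : K[X] →+* κ)
    (hC : φ (zeroCoeffs h g a b c d).cC = 0) : IsSquare (φ (zeroCoeffs h g a b c d).a) := by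
  obtain ⟨m, rfl⟩ := hg
  simp only [zeroCoeffs, map_sub, map_mul, map_pow, map_one] at hC ⊢
  refine ⟨φ (C a) ^ (h + 1) * φ X ^ (m + 1), ?_⟩
  linear_combination (-φ (C a)) * hC

/-- If `C'' = 0`, then `a ^ (2h+1) = θ'' ^ (g+1)`; as `g + 1` is even, `a` is a square. -/
theorem isSquare_of_inftyCoeffs (ha : a ≠ 0) (hg : Odd g) (φ : K[X] →+* κ)
    (hC : φ (inftyCoeffs h g a b c d).cC = 0) : IsSquare (φ (inftyCoeffs h g a b c d).a) := by
  obtain ⟨m, rfl⟩ := hg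
  simp only [inftyCoeffs, map_sub, map_pow] at hC ⊢
  have ha' : φ (C a) ≠ 0 := ((isUnit_C.2 ha.isUnit).map φ).ne_zero
  refine ⟨φ X ^ (m + 1) / φ (C a) ^ h, ?_⟩
  field_simp
  linear_combination hC

end

section
variable {K : Type u} [Field K] [CharZero K] {h g : ℕ} {a b c d : K}

/-- For odd `g` all fibres of a scheme over `ℙ¹` that contains the regular locus of the family as an
open subscheme are split. -/
theorem isSplit_fiber_of_odd (ha : a ≠ 0) (hb : b ≠ 0) (hg : Odd g) {Y : Scheme.{u}}
    {ρ : Y ⟶ P1 K} {j : (regularLocus (totalSpace h g a b c d)).toScheme ⟶ Y}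
    [IsOpenImmersion j]
    (hfac : j ≫ ρ = (regularLocus (totalSpace h g a b c d)).ι ≫ family h g a b c d) (θ : P1 K) :
    IsSplit (ρ.fiberToSpecResidueField θ) := by
  have h2 : IsUnit (2 : K[X]) := by
    have h2K : IsUnit (C 2 : K[X]) := isUnit_C.2 (two_ne_zero (α := K)).isUnit
    exact h2K
  have hunit : ∀ {r : K}, r ≠ 0 → IsUnit (C r : K[X]) := fun hr => isUnit_C.2 hr.isUnit
  obtain hθ | hθ := mem_range_pushout_inl_or_inr _ _ θ
  · have : IsOpenImmersion (P1.zeroChart K) := isOpenImmersion_pushout_inl _ _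
    let k : (zeroCoeffs h g a b c d).surface ⟶ totalSpace h g a b c d := pushout.inl _ _
    have : IsOpenImmersion k := isOpenImmersion_pushout_inl _ _
    exact isSplit_fiber hfac h2 (k := k) (P := zeroCoeffs h g a b c d) (c := P1.zeroChart K)
      (hunit ha) (pushout.inl_desc _ _ _)
      (fun φ => ⟨((hunit hb).map φ).ne_zero, isSquare_of_zeroCoeffs hg φ⟩) hθ
  · have : IsOpenImmersion (P1.inftyChart K) := isOpenImmersion_pushout_inr _ _
    let k : (inftyCoeffs h g a b c d).surface ⟶ totalSpace h g a b c d := pushout.inr _ _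
    have : IsOpenImmersion k := isOpenImmersion_pushout_inr _ _
    exact isSplit_fiber hfac h2 (k := k) (P := inftyCoeffs h g a b c d) (c := P1.inftyChart K)
      (hunit ha) (pushout.inr_desc _ _ _)
      (fun φ => ⟨((hunit hb).map φ).ne_zero, isSquare_of_inftyCoeffs ha hg φ⟩) hθ

end

end

end DP4Family

open CategoryTheory AlgebraicGeometry NumberField in
theorem mainTheorem8 {K : Type u} [Field K] [NumberField K]
    (Ω₀ : Finset (IsDedekindDomain.HeightOneSpectrum (𝓞 K)))
    (hΩ₀ : ∀ v ∈ Ω₀, (2 : 𝓞 K) ∉ v.asIdeal)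
    (a b c d : 𝓞 K) (habcd : DP4Family.IsArithmeticParameters Ω₀ a b c d)
    (h g : ℕ) (hg : Odd g)
    (Y : Scheme.{u}) (ρ : Y ⟶ DP4Family.P1 K)
    (j : (DP4Family.regularLocus (DP4Family.totalSpace h g (a : K) b c d)).toScheme ⟶ Y)
    (hY : DP4Family.IsSmoothCompactification
      ((DP4Family.regularLocus (DP4Family.totalSpace h g (a : K) b c d)).ι ≫
        DP4Family.family h g (a : K) b c d) j ρ)
    (θ : DP4Family.P1 K) (hθ : IsClosed {θ}) :
    DP4Family.IsSplit (ρ.fiberToSpecResidueField θ) := by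
  have := hY.isOpenImmersion
  exact DP4Family.isSplit_fiber_of_odd
    (RingOfIntegers.coe_ne_zero_iff.2 habcd.prime_a.ne_zero)
    (RingOfIntegers.coe_ne_zero_iff.2 habcd.prime_b.ne_zero) hg hY.fac θ
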